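/- Let $k$ be a field and let $Q$ be a quiver with finitely many vertices and arrows. Let $kQ$ be its path algebra: the $k$-algebra with basis all paths (including the trivial path $e_v$ at each vertex $v$), with product $pq$ the concatenation "first $p$, then $q$" if $p$ ends where $q$ starts and $pq=0$ otherwise, graded by path length. Let $\mathrm{Gr}\,kQ$ be the category of $\mathbb{Z}$-graded right $kQ$-modules with degree-preserving homomorphisms. A graded module is torsion if for each of its elements $m$ there is an $n$ with $m\,(kQ)_{\ge n}=0$. Let $\pi^*:\mathrm{Gr}\,kQ\to\mathrm{QGr}\,kQ$ be the quotient of $\mathrm{Gr}\,kQ$ by the Serre subcategory of torsion modules. A point module is a graded right module $M$ with $M=M_0\cdot kQ$ and $\dim_k M_i=1$ for all $i\ge 0$. A cycle is a closed path of positive length in which no arrow is repeated; a simple cycle is a closed path of positive length that visits no vertex twice, except that its first and last vertices coincide. A vertex is cyclic if it lies on a cycle. Assume that $kQ$ has finite Gelfand–Kirillov dimension; then exactly one simple cycle starts at each cyclic vertex $v$. Let $\mathcal{O}_v$ be the graded quotient of $e_v kQ$ by the right submodule spanned by all paths that start at $v$ and end at a vertex not on that simple cycle. Then: 1. For every cyclic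 vertex $v$, $\mathcal{O}_v$ is a point module and $\pi^*\mathcal{O}_v$ is a simple object of $\mathrm{QGr}\,kQ$. 2. Every simple object of $\mathrm{QGr}\,kQ$ is isomorphic to $\pi^*\mathcal{O}_v$ for some cyclic vertex $v$. 3. If $v,w$ are cyclic vertices and $\pi^*\mathcal{O}_v\cong\pi^*\mathcal{O}_w$ in $\mathrm{QGr}\,kQ$, then $v=w$. So the $\pi^*\mathcal{O}_v$, $v$ cyclic, form a complete and irredundant set of representatives of the isomorphism classes of simple objects of $\mathrm{QGr}\,kQ$. In particular, for every point module $P$ there is a cyclic vertex $v$ with $\pi^*P\cong\pi^*\mathcal{O}_v$, and there are only finitely many point modules up to isomorphism in $\mathrm{QGr}\,kQ$. -/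

import Mathlib

open CategoryTheory CategoryTheory.Limits

universe u v w t

/-! ### Paths and cycles in a quiver -/

section QuiverCycles

variable {V : Type v} [Quiver.{w} V]

/-- The list of arrows of a path, each recorded together with its source and target. -/
def Quiver.Path.arrowList {a : V} : ∀ {b : V}, Quiver.Path a b → List (Σ x y : V, x ⟶ y)
  | _, .nil => []
  | _, .cons (b := b) (c := c) p e => p.arrowList ++ [⟨b, c, e⟩]

/-- A cycle: a closed path of positive length in which no arrow is repeated. -/
def Quiver.Path.IsCycle {a : V} (p : Quiver.Path a a) : Prop :=
  0 < p.length ∧ p.arrowList.Nodup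

/-- A simple cycle: a closed path `(v₀, a₁, v₁, …, aₘ, vₘ = v₀)` of positive length such that
`v₁, …, vₘ` are pairwise distinct. -/
def Quiver.Path.IsSimpleCycle {a : V} (p : Quiver.Path a a) : Prop :=
  0 < p.length ∧ p.vertices.tail.Nodup

/-- A vertex is cyclic if it lies on some cycle. -/
def Quiver.IsCyclicVertex (v : V) : Prop :=
  ∃ (a : V) (p : Quiver.Path a a), p.IsCycle ∧ v ∈ p.vertices

/-- `u` lies on a simple cycle starting at `v`. When the quiver has no doubly cyclic
vertices there is at most one simple cycle starting at `v`, and this says that `u` lies on it. -/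
def Quiver.OnSimpleCycleAt (v u : V) : Prop :=
  ∃ p : Quiver.Path v v, p.IsSimpleCycle ∧ u ∈ p.vertices

/-- A path of length `n + 1` is an arrow followed by a path of length `n`. -/
theorem Quiver.Path.exists_cons_decomposition : ∀ {a b : V} (p : Quiver.Path a b) (n : ℕ),
    p.length = n + 1 →
    ∃ (c : V) (e : a ⟶ c) (q : Quiver.Path c b), q.length = n ∧ p = e.toPath.comp q
  | _, _, .nil, n, h => by simp at h
  | _, _, .cons .nil e, n, h => ⟨_, e, .nil, by simp at h ⊢; omega, rfl⟩
  | _, _, .cons (.cons p e) f, n, h => by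
    obtain ⟨c, e', q, hq, hp⟩ := Quiver.Path.exists_cons_decomposition (p.cons e) (n - 1) (by
      simp at h ⊢; omega)
    exact ⟨c, e', q.cons f, by simp at h ⊢; omega, by rw [hp]; rfl⟩

end QuiverCycles

/-! ### The path algebra -/

/-- The path algebra `kQ` of a quiver with vertex type `V`: the vector space with basis all
paths, including the trivial ones. -/
def PathAlgebra (k : Type u) [Field k] (V : Type v) [Quiver.{w} V] : Type max u v w :=
  (Σ a b : V, Quiver.Path a b) →₀ k

namespace PathAlgebra

noncomputable section

variable (k : Type u) [Field k] {V : Type v} [Quiver.{w} V]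

instance : AddCommGroup (PathAlgebra k V) :=
  inferInstanceAs (AddCommGroup ((Σ a b : V, Quiver.Path a b) →₀ k))

instance : Module k (PathAlgebra k V) :=
  inferInstanceAs (Module k ((Σ a b : V, Quiver.Path a b) →₀ k))

/-- The basis of `kQ` consisting of the paths. -/
def pathBasis : Module.Basis (Σ a b : V, Quiver.Path a b) k (PathAlgebra k V) :=
  ⟨LinearEquiv.refl k _⟩

/-- A path, viewed as an element of `kQ`. -/
def ofPath {a b : V} (p : Quiver.Path a b) : PathAlgebra k V :=
  pathBasis k ⟨a, b, p⟩

open Classical in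
/-- The product of two paths: the concatenation "first `p`, then `q`" if `q` starts where `p`
ends, and `0` otherwise. -/
def pathMul (p q : Σ a b : V, Quiver.Path a b) : PathAlgebra k V :=
  if h : q.1 = p.2.1 then ofPath k (p.2.2.comp (q.2.2.cast h rfl)) else 0

/-- The bilinear extension of the product of paths. -/
def mulHom : PathAlgebra k V →ₗ[k] PathAlgebra k V →ₗ[k] PathAlgebra k V :=
  (pathBasis k).constr k fun p => (pathBasis k).constr k fun q => pathMul k p q

instance : Mul (PathAlgebra k V) := ⟨fun x y => mulHom k x y⟩

theorem mul_eq (x y : PathAlgebra k V) : x * y = mulHom k x y := rfl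

theorem basis_mul_basis (p q : Σ a b : V, Quiver.Path a b) :
    pathBasis k p * pathBasis k q = pathMul k p q := by
  simp [mul_eq, mulHom, Module.Basis.constr_basis]

theorem ofPath_mul_ofPath {a b c : V} (p : Quiver.Path a b) (q : Quiver.Path b c) :
    ofPath k p * ofPath k q = ofPath k (p.comp q) := by
  rw [ofPath, ofPath, basis_mul_basis]
  simp [pathMul]

theorem ofPath_mul_ofPath_of_ne {a b b' c : V} (p : Quiver.Path a b) (q : Quiver.Path b' c)
    (h : b' ≠ b) : ofPath k p * ofPath k q = 0 := by
  rw [ofPath, ofPath, basis_mul_basis]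
  simp [pathMul, h]

@[elab_as_elim]
theorem path_induction {P : PathAlgebra k V → Prop} (x : PathAlgebra k V)
    (path : ∀ (a b : V) (p : Quiver.Path a b), P (ofPath k p)) (zero : P 0)
    (add : ∀ x y, P x → P y → P (x + y)) (smul : ∀ (c : k) x, P x → P (c • x)) : P x := by
  have hx : x ∈ Submodule.span k (Set.range (pathBasis k (V := V))) := by
    rw [(pathBasis k).span_eq]; trivial
  induction hx using Submodule.span_induction with
  | mem x h => obtain ⟨⟨a, b, p⟩, rfl⟩ := h; exact path a b p
  | zero => exact zero
  | add x y _ _ hx hy => exact add x y hx hy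
  | smul c x _ hx => exact smul c x hx

theorem aux_add_mul (x y z : PathAlgebra k V) : (x + y) * z = x * z + y * z := by
  simp [mul_eq]

theorem aux_mul_add (x y z : PathAlgebra k V) : x * (y + z) = x * y + x * z := by
  simp [mul_eq]

theorem aux_zero_mul (x : PathAlgebra k V) : 0 * x = 0 := by simp [mul_eq]

theorem aux_mul_zero (x : PathAlgebra k V) : x * 0 = 0 := by simp [mul_eq]

theorem aux_smul_mul (c : k) (x y : PathAlgebra k V) : (c • x) * y = c • (x * y) := by
  simp [mul_eq]

theorem aux_mul_smul (c : k) (x y : PathAlgebra k V) : x * (c • y) = c • (x * y) := by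
  simp [mul_eq]

theorem aux_mul_assoc (x y z : PathAlgebra k V) : x * y * z = x * (y * z) := by
  induction x using path_induction with
  | path a b p =>
    induction y using path_induction with
    | path b' c q =>
      induction z using path_induction with
      | path c' d r =>
        by_cases h : b' = b
        · subst h
          by_cases h' : c' = c
          · subst h'
            simp only [ofPath_mul_ofPath, Quiver.Path.comp_assoc]
          · rw [ofPath_mul_ofPath_of_ne k q r h', aux_mul_zero, ofPath_mul_ofPath,
              ofPath_mul_ofPath_of_ne k _ r h']
        · rw [ofPath_mul_ofPath_of_ne k p q h, aux_zero_mul]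
          by_cases h' : c' = c
          · subst h'
            rw [ofPath_mul_ofPath, ofPath_mul_ofPath_of_ne k p _ h]
          · rw [ofPath_mul_ofPath_of_ne k q r h', aux_mul_zero]
      | zero => simp only [aux_mul_zero]
      | add x y hx hy => simp only [aux_mul_add, hx, hy]
      | smul c x hx => simp only [aux_mul_smul, hx]
    | zero => simp only [aux_mul_zero, aux_zero_mul]
    | add x y hx hy => simp only [aux_mul_add, aux_add_mul, hx, hy]
    | smul c x hx => simp only [aux_mul_smul, aux_smul_mul, hx]
  | zero => simp only [aux_zero_mul]
  | add x y hx hy => simp only [aux_add_mul, hx, hy]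
  | smul c x hx => simp only [aux_smul_mul, hx]

/-- The component of degree `n` of `kQ`: the span of the paths of length `n`. -/
def grading (n : ℕ) : Submodule k (PathAlgebra k V) :=
  Submodule.span k {x | ∃ (a b : V) (p : Quiver.Path a b), p.length = n ∧ x = ofPath k p}

theorem ofPath_mem {a b : V} (p : Quiver.Path a b) : ofPath k p ∈ grading k p.length :=
  Submodule.subset_span ⟨a, b, p, rfl, rfl⟩

variable [Fintype V]

/-- The unit of `kQ` is the sum of all the trivial paths. -/
instance : One (PathAlgebra k V) := ⟨∑ v : V, ofPath k (Quiver.Path.nil : Quiver.Path v v)⟩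

theorem one_eq : (1 : PathAlgebra k V) =
    ∑ v : V, ofPath k (Quiver.Path.nil : Quiver.Path v v) := rfl

theorem aux_one_mul (x : PathAlgebra k V) : 1 * x = x := by
  induction x using path_induction with
  | path a b p =>
    have hs : (1 : PathAlgebra k V) * ofPath k p =
        ∑ v : V, ofPath k (Quiver.Path.nil : Quiver.Path v v) * ofPath k p := by
      simp [one_eq, mul_eq]
    rw [hs, Finset.sum_eq_single a, ofPath_mul_ofPath, Quiver.Path.nil_comp]
    · intro b _ hb
      exact ofPath_mul_ofPath_of_ne k _ _ hb.symm
    · simp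
  | zero => exact aux_mul_zero k 1
  | add x y hx hy => rw [aux_mul_add, hx, hy]
  | smul c x hx => rw [aux_mul_smul, hx]

theorem aux_mul_one (x : PathAlgebra k V) : x * 1 = x := by
  induction x using path_induction with
  | path a b p =>
    have hs : ofPath k p * (1 : PathAlgebra k V) =
        ∑ v : V, ofPath k p * ofPath k (Quiver.Path.nil : Quiver.Path v v) := by
      simp [one_eq, mul_eq]
    rw [hs, Finset.sum_eq_single b, ofPath_mul_ofPath, Quiver.Path.comp_nil]
    · intro b _ hb
      exact ofPath_mul_ofPath_of_ne k _ _ hb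
    · simp
  | zero => exact aux_zero_mul k 1
  | add x y hx hy => rw [aux_add_mul, hx, hy]
  | smul c x hx => rw [aux_smul_mul, hx]

instance : Ring (PathAlgebra k V) where
  __ := (inferInstance : AddCommGroup (PathAlgebra k V))
  mul := (· * ·)
  one := 1
  left_distrib := aux_mul_add k
  right_distrib := aux_add_mul k
  zero_mul := aux_zero_mul k
  mul_zero := aux_mul_zero k
  mul_assoc := aux_mul_assoc k
  one_mul := aux_one_mul k
  mul_one := aux_mul_one k

instance : Algebra k (PathAlgebra k V) :=
  Algebra.ofModule (aux_smul_mul k) (aux_mul_smul k)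

end

end PathAlgebra

/-! ### Graded modules -/

/-- A family of subspaces equipped with compatible projections gives a direct sum
decomposition. -/
theorem DirectSum.isInternal_of_proj {k : Type u} [Field k] {ι : Type v} [DecidableEq ι]
    {M : Type t} [AddCommGroup M] [Module k M] (deg : ι → Submodule k M)
    (pr : ι → M →ₗ[k] M) (h₁ : ∀ i, ∀ x ∈ deg i, pr i x = x)
    (h₂ : ∀ i j, i ≠ j → ∀ x ∈ deg i, pr j x = 0) (h₃ : iSup deg = ⊤) :
    DirectSum.IsInternal deg := by
  rw [DirectSum.isInternal_submodule_iff_iSupIndep_and_iSup_eq_top]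
  refine ⟨fun i => ?_, h₃⟩
  rw [Submodule.disjoint_def]
  intro x hx hx'
  have hle : (⨆ j, ⨆ (_ : j ≠ i), deg j) ≤ LinearMap.ker (pr i) :=
    iSup₂_le fun j hj y hy => h₂ j i hj y hy
  rw [← h₁ i x hx]
  exact hle hx'

/-- A `ℤ`-graded right module over the algebra `A` with grading `𝒜`. The action of `a` on `m`
from the right is `MulOpposite.op a • m`. -/
structure GrMod (k : Type u) [Field k] (A : Type v) [Ring A] [Algebra k A]
    (𝒜 : ℕ → Submodule k A) where
  /-- the underlying type -/
  carrier : Type t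
  [addCommGroup : AddCommGroup carrier]
  [moduleBase : Module k carrier]
  [module : Module Aᵐᵒᵖ carrier]
  [isScalarTower : IsScalarTower k Aᵐᵒᵖ carrier]
  /-- the homogeneous components -/
  deg : ℤ → Submodule k carrier
  isInternal : DirectSum.IsInternal deg
  smul_mem_deg : ∀ {i : ℤ} {n : ℕ} {m : carrier} {a : A}, m ∈ deg i → a ∈ 𝒜 n →
    MulOpposite.op a • m ∈ deg (i + n)

namespace GrMod

noncomputable section

attribute [instance] GrMod.addCommGroup GrMod.moduleBase GrMod.module GrMod.isScalarTower

variable {k : Type u} [Field k] {A : Type v} [Ring A] [Algebra k A] {𝒜 : ℕ → Submodule k A}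

instance : CoeSort (GrMod.{u, v, t} k A 𝒜) (Type t) := ⟨GrMod.carrier⟩

/-- A graded module is the direct sum of its components. -/
def decomp (M : GrMod.{u, v, t} k A 𝒜) : DirectSum ℤ (fun j => M.deg j) ≃ₗ[k] M :=
  LinearEquiv.ofBijective (DirectSum.coeLinearMap M.deg) (by exact M.isInternal)

theorem decomp_apply (M : GrMod.{u, v, t} k A 𝒜) (y : DirectSum ℤ (fun j => M.deg j)) :
    M.decomp y = DirectSum.coeLinearMap M.deg y := rfl

/-- The projection of a graded module onto its component of degree `i`. -/
def component (M : GrMod.{u, v, t} k A 𝒜) (i : ℤ) : M →ₗ[k] M :=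
  (M.deg i).subtype ∘ₗ DirectSum.component k ℤ (fun j => M.deg j) i ∘ₗ
    M.decomp.symm.toLinearMap

variable (M : GrMod.{u, v, t} k A 𝒜)

theorem component_mem (i : ℤ) (x : M) : M.component i x ∈ M.deg i := by
  simp [component]

theorem symm_of_mem {i : ℤ} {x : M} (hx : x ∈ M.deg i) :
    M.decomp.symm x = DirectSum.lof k ℤ (fun j => M.deg j) i ⟨x, hx⟩ := by
  rw [LinearEquiv.symm_apply_eq, decomp_apply]
  simp

theorem component_of_mem {i : ℤ} {x : M} (hx : x ∈ M.deg i) : M.component i x = x := by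
  simp [component, symm_of_mem M hx]

theorem component_of_mem_ne {i j : ℤ} (hij : i ≠ j) {x : M} (hx : x ∈ M.deg i) :
    M.component j x = 0 := by
  simp [component, symm_of_mem M hx, DirectSum.component.of, hij]

theorem iSup_deg : iSup M.deg = ⊤ := M.isInternal.submodule_iSup_eq_top

@[elab_as_elim]
theorem deg_induction {P : M → Prop} (x : M) (hom : ∀ i, ∀ x ∈ M.deg i, P x) (zero : P 0)
    (add : ∀ x y, P x → P y → P (x + y)) : P x := by
  have hx : x ∈ iSup M.deg := by rw [iSup_deg]; trivial
  exact Submodule.iSup_induction M.deg (motive := P) hx hom zero add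

theorem mem_iSup_component (x : M) {N : ℤ → Submodule k M}
    (h : ∀ i, M.component i x ∈ N i) : x ∈ iSup N := by
  classical
  have hx : x = ∑ i ∈ (M.decomp.symm x).support, M.component i x := by
    conv_lhs => rw [← M.decomp.apply_symm_apply x]
    rw [decomp_apply, DirectSum.coeLinearMap_eq_dfinsuppSum]
    rfl
  rw [hx]
  exact Submodule.sum_mem _ fun i _ => Submodule.mem_iSup_of_mem i (h i)

theorem ext_component {x y : M} (h : ∀ i, M.component i x = M.component i y) : x = y := by
  have : x - y ∈ iSup (fun _ : ℤ => (⊥ : Submodule k M)) :=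
    mem_iSup_component M _ fun i => by simp [h]
  simpa [sub_eq_zero] using this

theorem component_smul {n : ℕ} {a : A} (ha : a ∈ 𝒜 n) (i : ℤ) (x : M) :
    M.component i (MulOpposite.op a • x) = MulOpposite.op a • M.component (i - n) x := by
  induction x using deg_induction with
  | hom j x hx =>
    by_cases h : j = i - n
    · subst h
      have := M.smul_mem_deg hx ha
      rw [sub_add_cancel] at this
      rw [component_of_mem M hx, component_of_mem M this]
    · rw [component_of_mem_ne M h hx, smul_zero,
        component_of_mem_ne M (i := j + n) (by omega) (M.smul_mem_deg hx ha)]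
  | zero => simp
  | add x y hx hy => simp [smul_add, hx, hy]

/-- A submodule of a graded module is homogeneous if it contains the homogeneous components of
its elements. -/
def IsHomogeneous (N : Submodule Aᵐᵒᵖ M) : Prop :=
  ∀ x ∈ N, ∀ i, M.component i x ∈ N

theorem isHomogeneous_span [GradedAlgebra 𝒜] (S : Set M) (hS : ∀ x ∈ S, ∃ i, x ∈ M.deg i) :
    M.IsHomogeneous (Submodule.span Aᵐᵒᵖ S) := by
  intro x hx
  induction hx using Submodule.span_induction with
  | mem x h =>
    intro i
    obtain ⟨j, hj⟩ := hS x h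
    by_cases hij : j = i
    · subst hij
      rw [component_of_mem M hj]
      exact Submodule.subset_span h
    · rw [component_of_mem_ne M hij hj]
      exact Submodule.zero_mem _
  | zero => intro i; simp
  | add x y _ _ hx hy => intro i; rw [map_add]; exact Submodule.add_mem _ (hx i) (hy i)
  | smul a x _ hx =>
    induction a using MulOpposite.rec' with
    | _ a =>
      induction a using DirectSum.Decomposition.inductionOn 𝒜 with
      | zero => intro i; simp
      | homogeneous a =>
        intro i
        rw [component_smul M a.2]
        exact Submodule.smul_mem _ _ (hx _)
      | add a b ha hb =>
        intro i
        rw [MulOpposite.op_add, add_smul, map_add]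
        exact Submodule.add_mem _ (ha i) (hb i)

/-- The graded submodule attached to a homogeneous submodule. -/
def sub (N : Submodule Aᵐᵒᵖ M) (hN : M.IsHomogeneous N) : GrMod.{u, v, t} k A 𝒜 where
  carrier := N
  deg i := (M.deg i).comap (N.subtype.restrictScalars k)
  isInternal := by
    refine DirectSum.isInternal_of_proj _
      (fun i => (M.component i).restrict (p := N.restrictScalars k) (q := N.restrictScalars k)
        fun x hx => hN x hx i) ?_ ?_ ?_
    · intro i x hx
      exact Subtype.ext (component_of_mem M hx)
    · intro i j hij x hx
      exact Subtype.ext (component_of_mem_ne M hij hx)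
    · rw [eq_top_iff]
      rintro x -
      have h : (x : M) ∈ ⨆ i, M.deg i ⊓ N.restrictScalars k :=
        mem_iSup_component M x fun i => ⟨component_mem M i x, hN x x.2 i⟩
      have h' : (⨆ i, M.deg i ⊓ N.restrictScalars k) ≤
          (⨆ i, (M.deg i).comap (N.subtype.restrictScalars k)).map
            (N.subtype.restrictScalars k) := by
        refine iSup_le fun i y hy => ?_
        exact ⟨⟨y, hy.2⟩, Submodule.mem_iSup_of_mem i hy.1, rfl⟩
      obtain ⟨y, hy, hyx⟩ := h' h
      rwa [← Subtype.ext hyx]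
  smul_mem_deg := fun hm ha => M.smul_mem_deg hm ha

/-- The graded quotient module by a homogeneous submodule. -/
def quot (N : Submodule Aᵐᵒᵖ M) (hN : M.IsHomogeneous N) : GrMod.{u, v, t} k A 𝒜 where
  carrier := M ⧸ N
  deg i := (M.deg i).map (N.mkQ.restrictScalars k)
  isInternal := by
    refine DirectSum.isInternal_of_proj _
      (fun i => (N.restrictScalars k).mapQ (N.restrictScalars k) (M.component i)
        fun x hx => hN x hx i) ?_ ?_ ?_
    · rintro i _ ⟨x, hx, rfl⟩
      exact congrArg N.mkQ (component_of_mem M hx)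
    · rintro i j hij _ ⟨x, hx, rfl⟩
      exact (congrArg N.mkQ (component_of_mem_ne M hij hx)).trans (map_zero _)
    · rw [← Submodule.map_iSup, iSup_deg, Submodule.map_top, LinearMap.range_eq_top]
      exact N.mkQ_surjective
  smul_mem_deg := by
    rintro i n _ a ⟨x, hx, rfl⟩ ha
    exact ⟨_, M.smul_mem_deg hx ha, N.mkQ.map_smul _ _⟩

/-- The product of two graded modules. -/
def prod (M N : GrMod.{u, v, t} k A 𝒜) : GrMod.{u, v, t} k A 𝒜 where
  carrier := M × N
  deg i := (M.deg i).prod (N.deg i)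
  isInternal := by
    refine DirectSum.isInternal_of_proj _
      (fun i => (M.component i).prodMap (N.component i)) ?_ ?_ ?_
    · rintro i ⟨x, y⟩ ⟨hx, hy⟩
      exact Prod.ext (component_of_mem M hx) (component_of_mem N hy)
    · rintro i j hij ⟨x, y⟩ ⟨hx, hy⟩
      exact Prod.ext (component_of_mem_ne M hij hx) (component_of_mem_ne N hij hy)
    · rw [eq_top_iff]
      rintro ⟨x, y⟩ -
      have hx : (x, (0 : N)) ∈ ⨆ i, (M.deg i).prod (N.deg i) := by
        induction x using deg_induction with
        | hom i x hx => exact Submodule.mem_iSup_of_mem i ⟨hx, Submodule.zero_mem _⟩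
        | zero => exact Submodule.zero_mem _
        | add x y hx hy => simpa using Submodule.add_mem _ hx hy
      have hy : ((0 : M), y) ∈ ⨆ i, (M.deg i).prod (N.deg i) := by
        induction y using deg_induction with
        | hom i x hx => exact Submodule.mem_iSup_of_mem i ⟨Submodule.zero_mem _, hx⟩
        | zero => exact Submodule.zero_mem _
        | add x y hx hy => simpa using Submodule.add_mem _ hx hy
      simpa using Submodule.add_mem _ hx hy
  smul_mem_deg := fun hm ha => ⟨M.smul_mem_deg hm.1 ha, N.smul_mem_deg hm.2 ha⟩

variable (k A 𝒜) in
/-- The zero module. -/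
def zeroMod : GrMod.{u, v, t} k A 𝒜 where
  carrier := PUnit
  deg _ := ⊤
  isInternal := DirectSum.isInternal_of_proj _ (fun _ => 0) (fun _ _ _ => rfl)
    (fun _ _ _ _ _ => rfl) (by simp)
  smul_mem_deg := fun _ _ => Submodule.mem_top

variable (𝒜) in
/-- The algebra `A` as a graded right module over itself, concentrated in degrees `≥ 0`. -/
def regular [GradedAlgebra 𝒜] : GrMod.{u, v, v} k A 𝒜 where
  carrier := A
  deg i := if 0 ≤ i then 𝒜 i.toNat else ⊥
  isInternal := by
    refine DirectSum.isInternal_of_proj _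
      (fun i => if 0 ≤ i then GradedAlgebra.proj 𝒜 i.toNat else 0) ?_ ?_ ?_
    · intro i x hx
      by_cases hi : 0 ≤ i
      · simp only [hi, if_true] at hx ⊢
        simp [GradedAlgebra.proj_apply, DirectSum.decompose_of_mem_same 𝒜 hx]
      · simp only [hi, if_false, Submodule.mem_bot] at hx ⊢
        simp [hx]
    · intro i j hij x hx
      by_cases hi : 0 ≤ i
      · by_cases hj : 0 ≤ j
        · simp only [hi, hj, if_true] at hx ⊢
          simp [GradedAlgebra.proj_apply,
            DirectSum.decompose_of_mem_ne 𝒜 hx (show i.toNat ≠ j.toNat by omega)]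
        · simp [hj]
      · simp only [hi, if_false, Submodule.mem_bot] at hx
        simp [hx]
    · rw [eq_top_iff, ← (DirectSum.Decomposition.isInternal 𝒜).submodule_iSup_eq_top]
      refine iSup_le fun n => le_iSup_of_le (n : ℤ) ?_
      simp
  smul_mem_deg := by
    intro i n m a hm ha
    by_cases hi : 0 ≤ i
    · have hi' : 0 ≤ i + n := by omega
      simp only [hi, hi', if_true] at hm ⊢
      rw [show (i + n).toNat = i.toNat + n by omega]
      exact SetLike.mul_mem_graded hm ha
    · simp only [hi, if_false, Submodule.mem_bot] at hm
      rw [hm, smul_zero]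
      exact Submodule.zero_mem _

/-- Morphisms of graded modules: module homomorphisms preserving degrees. -/
@[ext]
structure Hom (M N : GrMod.{u, v, t} k A 𝒜) where
  /-- the underlying module homomorphism -/
  lin : M →ₗ[Aᵐᵒᵖ] N
  map_deg : ∀ {i : ℤ} {m : M}, m ∈ M.deg i → lin m ∈ N.deg i

/-- The category of graded right modules with degree preserving homomorphisms. -/
instance : Category (GrMod.{u, v, t} k A 𝒜) where
  Hom M N := Hom M N
  id M := ⟨LinearMap.id, fun h => h⟩
  comp f g := ⟨g.lin ∘ₗ f.lin, fun h => g.map_deg (f.map_deg h)⟩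

variable {M} {N P : GrMod.{u, v, t} k A 𝒜}

@[ext]
theorem hom_ext {f g : M ⟶ N} (h : ∀ x, f.lin x = g.lin x) : f = g :=
  Hom.ext (LinearMap.ext h)

@[simp] theorem id_lin (x : M) : Hom.lin (𝟙 M) x = x := rfl

@[simp] theorem comp_lin (f : M ⟶ N) (g : N ⟶ P) (x : M) : (f ≫ g).lin x = g.lin (f.lin x) := rfl

/-- A morphism of graded modules is `k`-linear. -/
def Hom.linBase (f : Hom M N) : M →ₗ[k] N where
  toFun := f.lin
  map_add' := map_add _
  map_smul' c x := by
    have h : ∀ (L : GrMod.{u, v, t} k A 𝒜) (y : L), c • y = (c • (1 : Aᵐᵒᵖ)) • y := by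
      intro L y; rw [smul_assoc, one_smul]
    rw [h M x, map_smul, RingHom.id_apply, h N]

theorem Hom.lin_component (f : Hom M N) (i : ℤ) (x : M) :
    f.lin (M.component i x) = N.component i (f.lin x) := by
  induction x using deg_induction with
  | hom j x hx =>
    by_cases h : j = i
    · subst h
      rw [component_of_mem M hx, component_of_mem N (f.map_deg hx)]
    · rw [component_of_mem_ne M h hx, component_of_mem_ne N h (f.map_deg hx), map_zero]
  | zero => simp
  | add x y hx hy => simp [hx, hy]

instance : Zero (M ⟶ N) := ⟨⟨0, fun _ => Submodule.zero_mem _⟩⟩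
instance : Add (M ⟶ N) := ⟨fun f g =>
  ⟨f.lin + g.lin, fun h => Submodule.add_mem _ (f.map_deg h) (g.map_deg h)⟩⟩
instance : Neg (M ⟶ N) := ⟨fun f => ⟨-f.lin, fun h => Submodule.neg_mem _ (f.map_deg h)⟩⟩
instance : Sub (M ⟶ N) := ⟨fun f g =>
  ⟨f.lin - g.lin, fun h => Submodule.sub_mem _ (f.map_deg h) (g.map_deg h)⟩⟩
instance : SMul ℕ (M ⟶ N) := ⟨fun n f => ⟨n • f.lin, fun h => by
  rw [LinearMap.smul_apply]; exact nsmul_mem (f.map_deg h) n⟩⟩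
instance : SMul ℤ (M ⟶ N) := ⟨fun n f => ⟨n • f.lin, fun h => by
  rw [LinearMap.smul_apply]; exact zsmul_mem (f.map_deg h) n⟩⟩

instance : AddCommGroup (M ⟶ N) :=
  Function.Injective.addCommGroup (fun f : M ⟶ N => f.lin) (fun _ _ h => Hom.ext h) rfl
    (fun _ _ => rfl) (fun _ => rfl) (fun _ _ => rfl) (fun _ _ => rfl) (fun _ _ => rfl)

@[simp] theorem zero_lin (x : M) : Hom.lin (0 : M ⟶ N) x = 0 := rfl

@[simp] theorem add_lin (f g : M ⟶ N) (x : M) : (f + g).lin x = f.lin x + g.lin x := rfl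

instance : Preadditive (GrMod.{u, v, t} k A 𝒜) where
  add_comp _ _ _ f g h := by ext x; simp
  comp_add _ _ _ f g h := by ext x; simp

end

end GrMod

/-! ### The category of graded modules is abelian -/

namespace GrMod

noncomputable section

variable {k : Type u} [Field k] {A : Type v} [Ring A] [Algebra k A] {𝒜 : ℕ → Submodule k A}
variable {M N P : GrMod.{u, v, t} k A 𝒜}

theorem isHomogeneous_ker (f : M ⟶ N) : M.IsHomogeneous (LinearMap.ker f.lin) := by
  intro x hx i
  rw [LinearMap.mem_ker] at hx ⊢
  rw [Hom.lin_component, hx, map_zero]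

theorem isHomogeneous_range (f : M ⟶ N) : N.IsHomogeneous (LinearMap.range f.lin) := by
  rintro _ ⟨x, rfl⟩ i
  exact ⟨M.component i x, Hom.lin_component f i x⟩

/-- The inclusion of a homogeneous submodule. -/
def subι (L : Submodule Aᵐᵒᵖ M) (hL : M.IsHomogeneous L) : M.sub L hL ⟶ M :=
  ⟨L.subtype, fun h => h⟩

/-- The projection onto the quotient by a homogeneous submodule. -/
def quotπ (L : Submodule Aᵐᵒᵖ M) (hL : M.IsHomogeneous L) : M ⟶ M.quot L hL :=
  ⟨L.mkQ, fun {_ m} h => ⟨m, h, rfl⟩⟩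

/-- A sequence `0 → M → N → P` that is exact on underlying modules exhibits a kernel. -/
def isLimitOfExact (f : M ⟶ N) (g : N ⟶ P) (w : f ≫ g = 0)
    (hf : Function.Injective f.lin) (hfg : ∀ y, g.lin y = 0 → ∃ x, f.lin x = y) :
    IsLimit (KernelFork.ofι f w) := by
  have key : ∀ {L : GrMod.{u, v, t} k A 𝒜} (h : L ⟶ N), h ≫ g = 0 →
      { l : L ⟶ M // l ≫ f = h } := by
    intro L h hh
    have hex : ∀ x, ∃ y, f.lin y = h.lin x := fun x => hfg _ (by rw [← comp_lin, hh, zero_lin])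
    choose l hl using hex
    let l' : L →ₗ[Aᵐᵒᵖ] M :=
      { toFun := l
        map_add' := fun x y => hf (by simp [hl])
        map_smul' := fun a x => hf (by simp [hl]) }
    refine ⟨⟨l', fun {i m} hm => ?_⟩, hom_ext hl⟩
    have h1 : l' m = M.component i (l' m) := hf (by
      rw [Hom.lin_component]
      change f.lin (l m) = N.component i (f.lin (l m))
      rw [hl, component_of_mem N (h.map_deg hm)])
    rw [h1]
    exact component_mem M i _
  refine KernelFork.IsLimit.ofι f w (fun h hh => (key h hh).1) (fun h hh => (key h hh).2) ?_
  intro L h hh m hm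
  refine hom_ext fun x => hf ?_
  have := (key h hh).2
  rw [← comp_lin, ← comp_lin, hm, this]

/-- A sequence `M → N → P → 0` that is exact on underlying modules exhibits a cokernel. -/
def isColimitOfExact (f : M ⟶ N) (g : N ⟶ P) (w : f ≫ g = 0)
    (hg : Function.Surjective g.lin) (hfg : ∀ y, g.lin y = 0 → ∃ x, f.lin x = y) :
    IsColimit (CokernelCofork.ofπ g w) := by
  have key : ∀ {L : GrMod.{u, v, t} k A 𝒜} (h : N ⟶ L), f ≫ h = 0 →
      { l : P ⟶ L // g ≫ l = h } := by
    intro L h hh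
    have hker : ∀ y y', g.lin y = g.lin y' → h.lin y = h.lin y' := by
      intro y y' hy
      obtain ⟨x, hx⟩ := hfg (y - y') (by rw [map_sub, hy, sub_self])
      rw [← sub_eq_zero, ← map_sub, ← hx, ← comp_lin, hh, zero_lin]
    let s := Function.surjInv hg
    have hs : ∀ z, g.lin (s z) = z := Function.surjInv_eq hg
    let l' : P →ₗ[Aᵐᵒᵖ] L :=
      { toFun := fun z => h.lin (s z)
        map_add' := fun x y => by
          rw [← map_add]; exact hker _ _ (by simp [hs])
        map_smul' := fun a x => by
          rw [RingHom.id_apply, ← map_smul]; exact hker _ _ (by simp [hs]) }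
    have hl' : ∀ y, l' (g.lin y) = h.lin y := fun y => hker _ _ (by simp [hs])
    refine ⟨⟨l', fun {i m} hm => ?_⟩, hom_ext hl'⟩
    have h1 : m = g.lin (N.component i (s m)) := by
      rw [Hom.lin_component, hs, component_of_mem P hm]
    rw [h1, hl']
    exact h.map_deg (component_mem N i _)
  refine CokernelCofork.IsColimit.ofπ g w (fun h hh => (key h hh).1)
    (fun h hh => (key h hh).2) ?_
  intro L h hh m hm
  refine hom_ext fun z => ?_
  obtain ⟨y, rfl⟩ := hg z
  have := (key h hh).2
  rw [← comp_lin, ← comp_lin, hm, this]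

theorem subι_comp (f : M ⟶ N) : subι _ (isHomogeneous_ker f) ≫ f = 0 :=
  hom_ext fun x => x.2

theorem comp_quotπ (f : M ⟶ N) : f ≫ quotπ _ (isHomogeneous_range f) = 0 :=
  hom_ext fun x => (Submodule.Quotient.mk_eq_zero _).2 ⟨x, rfl⟩

/-- The kernel of a morphism is the kernel of the underlying module homomorphism. -/
def kernelIsLimit (f : M ⟶ N) :
    IsLimit (KernelFork.ofι (subι _ (isHomogeneous_ker f)) (subι_comp f)) :=
  isLimitOfExact _ _ _ Subtype.val_injective fun y hy => ⟨⟨y, hy⟩, rfl⟩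

/-- The cokernel of a morphism is the cokernel of the underlying module homomorphism. -/
def cokernelIsColimit (f : M ⟶ N) :
    IsColimit (CokernelCofork.ofπ (quotπ _ (isHomogeneous_range f)) (comp_quotπ f)) :=
  isColimitOfExact _ _ _ (Submodule.mkQ_surjective _)
    fun _ hy => (Submodule.Quotient.mk_eq_zero _).1 hy

instance : HasKernels (GrMod.{u, v, t} k A 𝒜) := ⟨fun f => ⟨⟨⟨_, kernelIsLimit f⟩⟩⟩⟩

instance : HasCokernels (GrMod.{u, v, t} k A 𝒜) := ⟨fun f => ⟨⟨⟨_, cokernelIsColimit f⟩⟩⟩⟩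

theorem injective_of_mono (f : M ⟶ N) [Mono f] : Function.Injective f.lin := by
  rw [injective_iff_map_eq_zero]
  intro x hx
  have h : subι _ (isHomogeneous_ker f) = 0 := by
    rw [← cancel_mono f, subι_comp, zero_comp]
  exact congrArg (fun g : M.sub _ (isHomogeneous_ker f) ⟶ M => g.lin ⟨x, hx⟩) h

theorem surjective_of_epi (f : M ⟶ N) [Epi f] : Function.Surjective f.lin := by
  intro y
  have h : quotπ _ (isHomogeneous_range f) = 0 := by
    rw [← cancel_epi f, comp_quotπ, comp_zero]
  exact (Submodule.Quotient.mk_eq_zero _).1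
    (congrArg (fun g : N ⟶ N.quot _ (isHomogeneous_range f) => g.lin y) h)

instance : IsNormalMonoCategory (GrMod.{u, v, t} k A 𝒜) where
  normalMonoOfMono f _ := ⟨{
    Z := _
    g := quotπ _ (isHomogeneous_range f)
    w := comp_quotπ f
    isLimit := isLimitOfExact _ _ _ (injective_of_mono f)
      fun _ hy => (Submodule.Quotient.mk_eq_zero _).1 hy }⟩

instance : IsNormalEpiCategory (GrMod.{u, v, t} k A 𝒜) where
  normalEpiOfEpi f _ := ⟨{
    W := _
    g := subι _ (isHomogeneous_ker f)
    w := subι_comp f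
    isColimit := isColimitOfExact _ _ _ (surjective_of_epi f) fun y hy => ⟨⟨y, hy⟩, rfl⟩ }⟩

/-- The biproduct of two graded modules. -/
def binaryBicone (M N : GrMod.{u, v, t} k A 𝒜) : BinaryBicone M N where
  pt := M.prod N
  fst := ⟨LinearMap.fst _ _ _, fun h => h.1⟩
  snd := ⟨LinearMap.snd _ _ _, fun h => h.2⟩
  inl := ⟨LinearMap.inl _ _ _, fun h => ⟨h, Submodule.zero_mem _⟩⟩
  inr := ⟨LinearMap.inr _ _ _, fun h => ⟨Submodule.zero_mem _, h⟩⟩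
  inl_fst := rfl
  inl_snd := rfl
  inr_fst := rfl
  inr_snd := rfl

instance : HasBinaryBiproducts (GrMod.{u, v, t} k A 𝒜) :=
  ⟨fun M N => HasBinaryBiproduct.mk ⟨binaryBicone M N, isBinaryBilimitOfTotal _ (by
    refine hom_ext fun x => ?_
    exact Prod.ext (add_zero _) (zero_add _))⟩⟩

theorem isZero_zeroMod : IsZero (zeroMod.{u, v, t} k A 𝒜) := by
  rw [IsZero.iff_id_eq_zero]
  rfl

instance : HasZeroObject (GrMod.{u, v, t} k A 𝒜) := ⟨_, isZero_zeroMod⟩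

instance : HasFiniteProducts (GrMod.{u, v, t} k A 𝒜) :=
  hasFiniteProducts_of_has_binary_and_terminal

instance : Abelian (GrMod.{u, v, t} k A 𝒜) where

theorem exists_of_exact {S : ShortComplex (GrMod.{u, v, t} k A 𝒜)} (hS : S.Exact)
    (y : S.X₂) (hy : S.g.lin y = 0) : ∃ x, S.f.lin x = y := by
  have h := hS.comp_eq_zero (subι_comp S.g) (comp_quotπ S.f)
  exact (Submodule.Quotient.mk_eq_zero _).1
    (congrArg (fun g : S.X₂.sub _ (isHomogeneous_ker S.g) ⟶ S.X₂.quot _ (isHomogeneous_range S.f) =>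
      g.lin ⟨y, hy⟩) h)

variable (M) in
/-- An element `m` is torsion if `m A_{≥ n} = 0` for some `n`. -/
def IsTorsionElem (m : M) : Prop :=
  ∃ n : ℕ, ∀ i ≥ n, ∀ a ∈ 𝒜 i, MulOpposite.op a • m = 0

variable (k A 𝒜) in
/-- The torsion modules: all elements are torsion. -/
def torsion : ObjectProperty (GrMod.{u, v, t} k A 𝒜) :=
  fun M => ∀ m : M, M.IsTorsionElem m

variable (M) in
/-- Point modules: graded modules `M` with `M = M₀ A` and `dim Mᵢ = 1` for all `i ≥ 0`. -/
def IsPointModule : Prop :=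
  Submodule.span Aᵐᵒᵖ (M.deg 0 : Set M) = ⊤ ∧
    ∀ i : ℕ, Module.finrank k (M.deg (i : ℤ)) = 1

end

end GrMod

/-! ### Gelfand–Kirillov dimension -/

/-- The Gelfand–Kirillov dimension of a `k`-algebra: the supremum, over the finite-dimensional
subspaces `W`, of `limsup log (dim (k + W + W² + ⋯ + Wⁿ)) / log n`. -/
noncomputable def gkDim (k : Type u) [Field k] (A : Type v) [Ring A] [Algebra k A] : EReal :=
  ⨆ (W : Submodule k A) (_ : FiniteDimensional k W),
    Filter.limsup (fun n : ℕ =>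
      ((Real.log (Module.finrank k (∑ i ∈ Finset.range (n + 1), W ^ i : Submodule k A)) /
        Real.log n : ℝ) : EReal)) Filter.atTop

/-! ### Graded modules over a path algebra -/

namespace PathAlgebra

noncomputable section

variable (k : Type u) [Field k] {V : Type v} [Quiver.{w} V]

open Classical in
/-- The projection of `kQ` onto the span of the paths of length `n`. -/
def lengthProj (n : ℕ) : PathAlgebra k V →ₗ[k] PathAlgebra k V :=
  (pathBasis k).constr k fun p => if p.2.2.length = n then pathBasis k p else 0

theorem lengthProj_ofPath (n : ℕ) {a b : V} (p : Quiver.Path a b) :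
    lengthProj k n (ofPath k p) = if p.length = n then ofPath k p else 0 := by
  simp [lengthProj, ofPath, Module.Basis.constr_basis]

theorem grading_isInternal : DirectSum.IsInternal (grading k (V := V)) := by
  refine DirectSum.isInternal_of_proj _ (lengthProj k) ?_ ?_ ?_
  · intro n x hx
    induction hx using Submodule.span_induction with
    | mem x h => obtain ⟨a, b, p, hp, rfl⟩ := h; simp [lengthProj_ofPath, hp]
    | zero => simp
    | add x y _ _ hx hy => simp [hx, hy]
    | smul c x _ hx => simp [hx]
  · intro n m hnm x hx
    induction hx using Submodule.span_induction with
    | mem x h => obtain ⟨a, b, p, hp, rfl⟩ := h; simp [lengthProj_ofPath, hp, hnm]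
    | zero => simp
    | add x y _ _ hx hy => simp [hx, hy]
    | smul c x _ hx => simp [hx]
  · rw [eq_top_iff]
    rintro x -
    induction x using path_induction with
    | path a b p => exact Submodule.mem_iSup_of_mem _ (ofPath_mem k p)
    | zero => exact Submodule.zero_mem _
    | add x y hx hy => exact Submodule.add_mem _ hx hy
    | smul c x hx => exact Submodule.smul_mem _ c hx

variable [Fintype V]

instance : SetLike.GradedMonoid (grading k (V := V)) where
  one_mem := Submodule.sum_mem _ fun v _ => ofPath_mem k (Quiver.Path.nil : Quiver.Path v v)
  mul_mem := by
    intro i j x y hx hy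
    induction hx using Submodule.span_induction with
    | mem x h =>
      obtain ⟨a, b, p, rfl, rfl⟩ := h
      induction hy using Submodule.span_induction with
      | mem y h =>
        obtain ⟨b', c, q, rfl, rfl⟩ := h
        by_cases hb : b' = b
        · subst hb
          rw [ofPath_mul_ofPath, ← Quiver.Path.length_comp]
          exact ofPath_mem k _
        · rw [ofPath_mul_ofPath_of_ne k p q hb]
          exact Submodule.zero_mem _
      | zero => rw [mul_zero]; exact Submodule.zero_mem _
      | add x y _ _ hx hy => rw [mul_add]; exact Submodule.add_mem _ hx hy
      | smul c x _ hx => rw [mul_smul_comm]; exact Submodule.smul_mem _ c hx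
    | zero => rw [zero_mul]; exact Submodule.zero_mem _
    | add x y _ _ hx hy => rw [add_mul]; exact Submodule.add_mem _ hx hy
    | smul c x _ hx => rw [smul_mul_assoc]; exact Submodule.smul_mem _ c hx

instance : GradedAlgebra (grading k (V := V)) where
  __ := (grading_isInternal k (V := V)).chooseDecomposition

end

end PathAlgebra

/-- The category `Gr kQ` of `ℤ`-graded right modules over the path algebra `kQ`. -/
abbrev Gr (k : Type u) [Field k] (V : Type v) [Quiver.{w} V] [Fintype V] :=
  GrMod.{u, max u v w, max u v w} k (PathAlgebra k V) (PathAlgebra.grading k)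

namespace Gr

noncomputable section

variable (k : Type u) [Field k] (V : Type v) [Quiver.{w} V] [Fintype V]

/-- The torsion modules in `Gr kQ`. -/
abbrev Tors : ObjectProperty (Gr.{u, v, w} k V) := GrMod.torsion k (PathAlgebra k V) _

variable {k V}

/-- To be annihilated by a homogeneous component of `kQ` it suffices to be annihilated by
the paths it contains. -/
theorem smul_eq_zero_of_path (M : Gr.{u, v, w} k V) (m : M) (i : ℕ)
    (h : ∀ (a b : V) (p : Quiver.Path a b), p.length = i →
      MulOpposite.op (PathAlgebra.ofPath k p) • m = 0)
    (a : PathAlgebra k V) (ha : a ∈ PathAlgebra.grading k i) : MulOpposite.op a • m = 0 := by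
  induction ha using Submodule.span_induction with
  | mem x hx => obtain ⟨a, b, p, hp, rfl⟩ := hx; exact h a b p hp
  | zero => simp
  | add x y _ _ hx hy => rw [MulOpposite.op_add, add_smul, hx, hy, add_zero]
  | smul c x _ hx => rw [MulOpposite.op_smul, smul_assoc, hx, smul_zero]

variable [∀ a b : V, Finite (a ⟶ b)]

/-- If `m a` is torsion for all `a` of large degree, then `m` is torsion. -/
theorem isTorsionElem_of_tail (M : Gr.{u, v, w} k V) (n : ℕ) : ∀ m : M,
    (∀ i ≥ n, ∀ a ∈ PathAlgebra.grading k (V := V) i, M.IsTorsionElem (MulOpposite.op a • m)) →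
      M.IsTorsionElem m := by
  induction n with
  | zero =>
    intro m h
    simpa using h 0 le_rfl 1 (SetLike.GradedOne.one_mem)
  | succ n ih =>
    intro m h
    have harrow : ∀ x : Σ a b : V, a ⟶ b,
        M.IsTorsionElem (MulOpposite.op (PathAlgebra.ofPath k x.2.2.toPath) • m) := by
      rintro ⟨a, b, e⟩
      refine ih _ fun i hi x hx => ?_
      rw [smul_smul, ← MulOpposite.op_mul]
      exact h (1 + i) (by omega) _
        (SetLike.mul_mem_graded (PathAlgebra.ofPath_mem k e.toPath) hx)
    choose N hN using harrow
    obtain ⟨B, hB⟩ := (Set.finite_range N).bddAbove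
    refine ⟨B + 1, fun i hi => smul_eq_zero_of_path M m i fun a b p hp => ?_⟩
    obtain ⟨c, e, q, hq, rfl⟩ := Quiver.Path.exists_cons_decomposition p (i - 1) (by omega)
    rw [← PathAlgebra.ofPath_mul_ofPath, MulOpposite.op_mul, ← smul_smul]
    have hle : N ⟨a, c, e⟩ ≤ B := hB ⟨_, rfl⟩
    exact hN ⟨a, c, e⟩ q.length (by omega) _ (PathAlgebra.ofPath_mem k q)

instance : (Tors.{u, v, w} k V).IsSerreClass where
  exists_zero := ⟨_, GrMod.isZero_zeroMod, fun m => ⟨0, fun _ _ _ _ => rfl⟩⟩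
  prop_of_mono {M N} f _ hN m := by
    obtain ⟨n, hn⟩ := hN (f.lin m)
    refine ⟨n, fun i hi a ha => GrMod.injective_of_mono f ?_⟩
    rw [map_smul, hn i hi a ha, map_zero]
  prop_of_epi {M N} f _ hM y := by
    obtain ⟨m, rfl⟩ := GrMod.surjective_of_epi f y
    obtain ⟨n, hn⟩ := hM m
    refine ⟨n, fun i hi a ha => ?_⟩
    rw [← map_smul, hn i hi a ha, map_zero]
  prop_X₂_of_shortExact {S} hS h₁ h₃ m := by
    obtain ⟨n, hn⟩ := h₃ (S.g.lin m)
    refine isTorsionElem_of_tail _ n m fun i hi a ha => ?_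
    obtain ⟨x, hx⟩ := GrMod.exists_of_exact hS.exact (MulOpposite.op a • m) (by
      exact (map_smul S.g.lin _ m).trans (hn i hi a ha))
    obtain ⟨n', hn'⟩ := h₁ x
    refine ⟨n', fun j hj b hb => ?_⟩
    rw [← hx, ← map_smul, hn' j hj b hb, map_zero]

end

end Gr

/-! ### The quotient category `QGr kQ` -/

section QuotientCategory

variable (k : Type u) [Field k] (V : Type v) [Quiver.{w} V] [Fintype V]
  [∀ a b : V, Finite (a ⟶ b)]

/-- The quotient of the abelian category `Gr kQ` by the Serre subcategory of torsion modules. -/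
abbrev QGr := (Gr.Tors.{u, v, w} k V).isoModSerre.Localization

/-- The quotient functor `π* : Gr kQ ⥤ QGr kQ`. -/
noncomputable abbrev QGr.proj : Gr.{u, v, w} k V ⥤ QGr.{u, v, w} k V :=
  (Gr.Tors.{u, v, w} k V).isoModSerre.Q

noncomputable instance : Abelian (QGr.{u, v, w} k V) :=
  ObjectProperty.SerreClassLocalization.abelian (QGr.proj.{u, v, w} k V) (Gr.Tors.{u, v, w} k V)

end QuotientCategory

/-! ### Cyclic point modules -/

namespace Gr

noncomputable section

variable (k : Type u) [Field k] {V : Type v} [Quiver.{w} V] [Fintype V]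

/-- The graded right module `kQ`. -/
abbrev regular : Gr.{u, v, w} k V :=
  GrMod.regular (A := PathAlgebra k V) (PathAlgebra.grading k)

/-- A path, viewed as an element of the graded module `kQ`. -/
def path {a b : V} (p : Quiver.Path a b) : regular.{u, v, w} k (V := V) :=
  PathAlgebra.ofPath k p

theorem path_mem_deg {a b : V} (p : Quiver.Path a b) :
    path k p ∈ (regular k (V := V)).deg p.length := by
  change PathAlgebra.ofPath k p ∈ (if (0 : ℤ) ≤ p.length then PathAlgebra.grading k (p.length : ℤ).toNat else ⊥)
  simpa using PathAlgebra.ofPath_mem k p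

/-- The graded right module `e_v kQ`, as a submodule of `kQ`. -/
def vertexModule (v : V) : Gr.{u, v, w} k V :=
  (regular k).sub
    (Submodule.span (PathAlgebra k V)ᵐᵒᵖ
      {path k (Quiver.Path.nil : Quiver.Path v v)})
    (GrMod.isHomogeneous_span _ _ (by
      rintro _ rfl
      exact ⟨_, path_mem_deg k _⟩))

/-- The inclusion of `e_v kQ` in `kQ`. -/
def vertexModuleInclusion (v : V) : vertexModule.{u, v, w} k v ⟶ regular k :=
  GrMod.subι _ _

/-- The right submodule of `e_v kQ` spanned by the paths that start at `v` and end at a vertex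
which is not on the simple cycle through `v`. -/
def offCycle (v : V) : Submodule (PathAlgebra k V)ᵐᵒᵖ (vertexModule.{u, v, w} k v) :=
  Submodule.span _ {x | ∃ (z : V) (q : Quiver.Path v z), ¬ Quiver.OnSimpleCycleAt v z ∧
    (vertexModuleInclusion k v).lin x = path k q}

theorem isHomogeneous_offCycle (v : V) : (vertexModule.{u, v, w} k v).IsHomogeneous
    (offCycle k v) := by
  refine GrMod.isHomogeneous_span _ _ ?_
  rintro x ⟨z, q, -, hx⟩
  refine ⟨q.length, ?_⟩
  have h := path_mem_deg k q
  rw [← hx] at h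
  exact h

/-- The cyclic point module `𝒪_v` of a cyclic vertex `v`: the quotient of `e_v kQ` by the right
submodule spanned by the paths that start at `v` and leave the simple cycle through `v`. -/
def cyclicPointModule (v : V) : Gr.{u, v, w} k V :=
  (vertexModule k v).quot (offCycle k v) (isHomogeneous_offCycle k v)

end

end Gr

/-! ### Returning paths and simple cycles -/

namespace Quiver

variable {V : Type v} [Quiver.{w} V]

/-! A path from `v` is called returning if some path leads from its end back to `v`. Two different
simple cycles `p`, `q` at one vertex would give distinct closed paths `pq` and `qp` of equal length;
these generate a free monoid, so `kQ` would grow exponentially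
(`uniqueSimpleCycles_of_gkDim_lt_top`). Finite Gelfand–Kirillov dimension therefore gives
`UniqueSimpleCycles`: at each vertex at most one arrow has a way back, and a cyclic vertex has
exactly one returning path of each length (`IsRecurrent.exists_path`, `path_unique`), the one
winding round its cycle. The other paths span a right ideal `nonReturning k v` of codimension one in
each degree, and `𝒪_v` is in effect the quotient of `kQ` by it.

The main tool is `IsCyclicGenerator`: a homogeneous element supported at `v` whose annihilator up to
torsion is `nonReturning k v` (`isTorsionElem_iff`). Every non-torsion module contains one
(`exists_isCyclicGenerator`): take a non-torsion homogeneous element at a vertex from which as few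
vertices as possible can be reached. If the generator `m` spans a submodule with torsion quotient,
the module is simple in `QGr kQ`, because a non-torsion homogeneous submodule contains some `m p`
with `p` returning; and its class depends only on the vertex and the degree
(`IsCyclicGenerator.nonempty_iso`). Multiplying by returning paths moves the vertex along the cycle
and raises the degree, so every such generator matches one in some `𝒪_w`. This covers simple
objects, where a non-torsion submodule has torsion quotient, and point modules, where the multiples
of `m` fill all large degrees.

For irredundancy, consider large degrees divisible by the lengths of a closed path at `v` and of one
at `w`: there `𝒪_v` lives at the vertex `v` and `𝒪_w` at `w`, so an isomorphism up to torsion forces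
`v = w`. -/

/-- A vertex is recurrent if some closed path of positive length starts at it. -/
def IsRecurrent (v : V) : Prop := ∃ p : Path v v, 0 < p.length

/-- At most one simple cycle starts at each vertex. -/
def UniqueSimpleCycles (V : Type v) [Quiver.{w} V] : Prop :=
  ∀ (v : V) (p q : Path v v), p.IsSimpleCycle → q.IsSimpleCycle → p = q

namespace Path

/-- A path of minimal length between two vertices visits no vertex twice. -/
theorem nodup_vertices_of_minimal {a : V} : ∀ {b : V} (p : Path a b),
    (∀ q : Path a b, p.length ≤ q.length) → p.vertices.Nodup
  | _, .nil, _ => by simp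
  | _, .cons (b := c) (c := b) p e, h => by
    rw [vertices_cons, List.concat_eq_append]
    refine List.Nodup.append (nodup_vertices_of_minimal p fun q => ?_) (by simp) ?_
    · simpa using h (q.cons e)
    · rw [List.disjoint_singleton]
      intro hb
      -- An earlier visit to the end vertex would make the prefix `p₁` a strictly shorter
      -- competitor.
      obtain ⟨p₁, p₂, rfl⟩ := exists_eq_comp_of_mem_vertices p hb
      have := h p₁
      simp at this

theorem exists_nodup_vertices {a b : V} (p : Path a b) : ∃ q : Path a b, q.vertices.Nodup := by
  obtain ⟨q, hq⟩ := exists_minimalFor_of_wellFoundedLT (fun _ : Path a b => True) length ⟨p, trivial⟩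
  exact ⟨q, nodup_vertices_of_minimal q fun r => by
    rcases le_total q.length r.length with h | h
    · exact h
    · exact hq.2 trivial h⟩

/-- An arrow followed by a path back to its source that repeats no vertex is a simple cycle. -/
theorem isSimpleCycle_toPath_comp {a b : V} (e : a ⟶ b) (q : Path b a) (hq : q.vertices.Nodup) :
    (e.toPath.comp q).IsSimpleCycle := by
  refine ⟨by simp, ?_⟩
  simpa [vertices_comp, Hom.toPath] using hq

/-- Links the two notions of cycle: a repeated arrow would repeat its target. -/
theorem map_arrowList {a : V} : ∀ {b : V} (p : Path a b),
    p.arrowList.map (fun x => x.2.1) = p.vertices.tail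
  | _, .nil => rfl
  | _, .cons p e => by
    have := map_arrowList p
    rw [arrowList, List.map_append, this, vertices_cons, List.concat_eq_append,
      List.tail_append_of_ne_nil p.vertices_ne_nil]
    rfl

theorem IsSimpleCycle.isCycle {a : V} {p : Path a a} (hp : p.IsSimpleCycle) : p.IsCycle :=
  ⟨hp.1, List.Nodup.of_map (fun x => x.2.1) (by rw [map_arrowList]; exact hp.2)⟩

/-- The `n`-fold iterate of a closed path. -/
def iter {a : V} (p : Path a a) : ℕ → Path a a
  | 0 => .nil
  | n + 1 => (p.iter n).comp p

theorem length_iter {a : V} (p : Path a a) (n : ℕ) : (p.iter n).length = n * p.length := by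
  induction n with
  | zero => simp [iter]
  | succ n ih => rw [iter, length_comp, ih]; ring

end Path

theorem isRecurrent_of_path {a b : V} (h : IsRecurrent a) (p : Path a b) (q : Path b a) :
    IsRecurrent b := by
  obtain ⟨r, hr⟩ := h
  exact ⟨q.comp (r.comp p), by simp; omega⟩

theorem IsCyclicVertex.isRecurrent {v : V} (h : IsCyclicVertex v) : IsRecurrent v := by
  obtain ⟨a, p, hp, hv⟩ := h
  obtain ⟨p₁, p₂, rfl⟩ := p.exists_eq_comp_of_mem_vertices hv
  exact isRecurrent_of_path ⟨_, hp.1⟩ p₁ p₂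

theorem IsRecurrent.exists_arrow {v : V} (h : IsRecurrent v) :
    ∃ (u : V) (_ : v ⟶ u), Nonempty (Path u v) := by
  obtain ⟨p, hp⟩ := h
  obtain ⟨c, e, q, -, -⟩ := p.exists_cons_decomposition (p.length - 1) (by omega)
  exact ⟨c, e, ⟨q⟩⟩

theorem IsRecurrent.exists_isSimpleCycle {v : V} (h : IsRecurrent v) :
    ∃ p : Path v v, p.IsSimpleCycle := by
  obtain ⟨u, e, ⟨q⟩⟩ := h.exists_arrow
  obtain ⟨r, hr⟩ := q.exists_nodup_vertices
  exact ⟨_, Path.isSimpleCycle_toPath_comp e r hr⟩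

/-- Recurrence agrees with cyclicity but carries no condition on repetitions, so it is easily
transported along paths with a way back. -/
theorem IsRecurrent.isCyclicVertex {v : V} (h : IsRecurrent v) : IsCyclicVertex v := by
  obtain ⟨p, hp⟩ := h.exists_isSimpleCycle
  exact ⟨v, p, hp.isCycle, p.start_mem_vertices⟩

/-- At a recurrent vertex there are arbitrarily long paths with a way back. -/
theorem IsRecurrent.exists_path {v : V} (h : IsRecurrent v) (n : ℕ) :
    ∃ (u : V) (p : Path v u), p.length = n ∧ Nonempty (Path u v) := by
  obtain ⟨p, hp⟩ := h
  -- The `n`-th iterate has length at least `n`; cut after `n` arrows, its remainder is the way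
  -- back.
  obtain ⟨u, p₁, p₂, -, hl⟩ := (p.iter n).exists_eq_comp_of_le_length (n := n) (by
    rw [Path.length_iter]; exact Nat.le_mul_of_pos_right n hp)
  exact ⟨u, p₁, hl, ⟨p₂⟩⟩

/-- The target of the first arrow is read off as the second vertex. The conclusion is an equality of
pairs, so that destructuring it identifies targets and arrows at once. -/
theorem toPath_comp_inj {a b b' c : V} (e : a ⟶ b) (e' : a ⟶ b') (q : Path b c) (q' : Path b' c)
    (h : e.toPath.comp q = e'.toPath.comp q') :
    (⟨b, e⟩ : Σ' x, a ⟶ x) = ⟨b', e'⟩ := by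
  have hl : q.length = q'.length := by
    have := congrArg Path.length h
    simpa using this
  have hv := congrArg Path.vertices h
  have hb : b = b' := by
    have := congrArg (fun l : List V => l.tail.head?) hv
    simpa [Path.vertices_comp, Hom.toPath, Path.vertices_head?] using this
  subst hb
  have := (Path.comp_inj hl).1 h
  have h2 := Path.hom_heq_of_cons_eq_cons this.1
  rw [eq_of_heq h2]

/-! ### Returning paths when simple cycles are unique -/

section Unique

variable (H : UniqueSimpleCycles V)

include H

/-- At most one arrow at each vertex has a way back. -/
theorem UniqueSimpleCycles.arrow_unique {a b b' : V} (e : a ⟶ b) (e' : a ⟶ b')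
    (q : Path b a) (q' : Path b' a) : (⟨b, e⟩ : Σ' x, a ⟶ x) = ⟨b', e'⟩ := by
  obtain ⟨r, hr⟩ := q.exists_nodup_vertices
  obtain ⟨r', hr'⟩ := q'.exists_nodup_vertices
  exact toPath_comp_inj e e' r r' (H a _ _ (Path.isSimpleCycle_toPath_comp e r hr)
    (Path.isSimpleCycle_toPath_comp e' r' hr'))

/-- At most one path of given length starts at `a` and has a way back. -/
theorem UniqueSimpleCycles.path_unique (n : ℕ) : ∀ {a b b' : V} (p : Path a b) (p' : Path a b')
    (_ : Path b a) (_ : Path b' a) (_ : p.length = n) (_ : p'.length = n),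
    (⟨b, p⟩ : Σ x, Path a x) = ⟨b', p'⟩ := by
  induction n with
  | zero =>
    intro a b b' p p' _ _ h h'
    obtain rfl := p.eq_of_length_zero h
    obtain rfl := p'.eq_of_length_zero h'
    rw [p.eq_nil_of_length_zero h, p'.eq_nil_of_length_zero h']
  | succ n ih =>
    intro a b b' p p' q q' h h'
    obtain ⟨c, e, r, hr, rfl⟩ := p.exists_cons_decomposition n h
    obtain ⟨c', e', r', hr', rfl⟩ := p'.exists_cons_decomposition n h'
    -- Each first arrow returns through the rest of its path. Once these arrows agree, the remaining
    -- paths return to `c` by going back to `a` and then along `e`.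
    obtain ⟨⟩ := H.arrow_unique e e' (r.comp q) (r'.comp q')
    obtain ⟨⟩ := ih r r' (q.comp e.toPath) (q'.comp e.toPath) hr hr'
    rfl

/-- The vertices on the simple cycle at `v` are those that can be reached from `v` and have a
way back to `v`. -/
theorem UniqueSimpleCycles.onSimpleCycleAt_iff {v u : V} (hv : IsRecurrent v) (p : Path v u) :
    OnSimpleCycleAt v u ↔ Nonempty (Path u v) := by
  constructor
  · rintro ⟨c, -, hu⟩
    obtain ⟨-, c₂, -⟩ := c.exists_eq_comp_of_mem_vertices hu
    exact ⟨c₂⟩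
  rintro ⟨q⟩
  obtain ⟨c, hc⟩ := hv.exists_isSimpleCycle
  refine ⟨c, hc, ?_⟩
  induction p with
  | nil => exact c.start_mem_vertices
  | @cons a b p e ih =>
    have ha := ih (e.toPath.comp q)
    -- The cycle `c` has an arrow leaving `a`, with a way back. The arrow `e` has one too, so the
    -- two coincide and the target of `e` is on `c`. If `a` is the end of `c`, the first arrow of
    -- `c` serves.
    have key : ∃ (x : V) (_ : a ⟶ x), x ∈ c.vertices ∧ Nonempty (Path x a) := by
      have aux : ∀ {a : V} (c₁ : Path v a) (c₂ : Path a v), c = c₁.comp c₂ → 0 < c₂.length →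
          ∃ (x : V) (_ : a ⟶ x), x ∈ c.vertices ∧ Nonempty (Path x a) := by
        intro a c₁ c₂ hcc hl
        obtain ⟨x, e', r, -, rfl⟩ := c₂.exists_cons_decomposition (c₂.length - 1) (by omega)
        refine ⟨x, e', ?_, ⟨r.comp c₁⟩⟩
        rw [hcc, ← Path.comp_assoc, Path.vertices_comp]
        exact List.mem_append_right _ r.start_mem_vertices
      obtain ⟨c₁, c₂, hcc⟩ := c.exists_eq_comp_of_mem_vertices ha
      rcases Nat.eq_zero_or_pos c₂.length with h0 | h0
      · obtain rfl := c₂.eq_of_length_zero h0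
        exact aux .nil c (by simp) hc.1
      · exact aux c₁ c₂ hcc h0
    obtain ⟨x, e', hx, ⟨r⟩⟩ := key
    obtain ⟨⟩ := H.arrow_unique e e' (q.comp p) r
    exact hx

end Unique

end Quiver

/-! ### Finite Gelfand–Kirillov dimension forces uniqueness of simple cycles -/

namespace Quiver.Path

variable {V : Type v} [Quiver.{w} V]

theorem length_eq_zero_of_nodup_vertices {a : V} :
    ∀ (p : Path a a), p.vertices.Nodup → p.length = 0
  | .nil, _ => rfl
  | .cons p e, h => by
    rw [vertices_cons, List.concat_eq_append] at h
    exact absurd rfl ((List.nodup_append.1 h).2.2 a p.start_mem_vertices a (by simp))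

/-- A simple cycle is not the concatenation of two closed paths of positive length. -/
theorem IsSimpleCycle.length_eq_zero {a : V} {p q : Path a a} (h : (p.comp q).IsSimpleCycle)
    (hp : 0 < p.length) : q.length = 0 := by
  -- As `p` is non-trivial, all vertices of `q`, including its first, occur in the tail of the
  -- vertex list of `p.comp q`; so the closed path `q` repeats no vertex.
  refine q.length_eq_zero_of_nodup_vertices ?_
  have h2 := h.2
  rw [vertices_comp, List.tail_append_of_ne_nil] at h2
  · exact (List.nodup_append.1 h2).2.1
  · intro h0
    have := congrArg List.length h0
    rw [List.length_dropLast, vertices_length] at this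
    simp only [List.length_nil] at this
    omega

theorem end_eq_of_comp_eq {a b b' c : V} {p : Path a b} {q : Path b c} {p' : Path a b'}
    {q' : Path b' c} (h : p.comp q = p'.comp q') (hl : p.length = p'.length) : b = b' := by
  have h1 := vertices_comp_get_length_eq p q
  have h2 := vertices_comp_get_length_eq p' q'
  simp only [List.get_eq_getElem] at h1 h2
  rw [← h1, ← h2]
  simp only [h, hl]

/-- Comparing prefixes shows that `q` begins with `p`, and a simple cycle has no proper initial
segment that is closed and non-trivial. -/
theorem IsSimpleCycle.eq_of_comp_comm_of_le {a : V} {p q : Path a a} (hp : p.IsSimpleCycle)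
    (hq : q.IsSimpleCycle) (h : p.comp q = q.comp p) (hle : p.length ≤ q.length) : p = q := by
  obtain ⟨z, q₁, q₂, rfl, hl⟩ := q.exists_eq_comp_of_le_length hle
  rw [comp_assoc q₁] at h
  obtain rfl := end_eq_of_comp_eq h hl.symm
  have h0 := hq.length_eq_zero (by rw [hl]; exact hp.1)
  rw [eq_nil_of_length_zero _ h0] at h ⊢
  exact ((comp_inj' hl.symm).1 h).1

/-- Distinct simple cycles do not commute. -/
theorem IsSimpleCycle.eq_of_comp_comm {a : V} {p q : Path a a} (hp : p.IsSimpleCycle)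
    (hq : q.IsSimpleCycle) (h : p.comp q = q.comp p) : p = q := by
  rcases le_total p.length q.length with hle | hle
  · exact hp.eq_of_comp_comm_of_le hq h hle
  · exact (hq.eq_of_comp_comm_of_le hp h.symm hle).symm

/-- The words of length `n` in two closed paths. -/
def word {a : V} (x y : Path a a) : ∀ n : ℕ, (Fin n → Bool) → Path a a
  | 0, _ => .nil
  | n + 1, f => (cond (f 0) x y).comp (word x y n (Fin.tail f))

/-- Since both blocks have the same length, a word can be read back block by block. -/
theorem word_injective {a : V} {x y : Path a a} (hl : x.length = y.length) (hxy : x ≠ y) (n : ℕ) :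
    Function.Injective (word x y n) := by
  induction n with
  | zero => intro f g _; exact Subsingleton.elim f g
  | succ n ih =>
    intro f g h
    have hlen : (cond (f 0) x y).length = (cond (g 0) x y).length := by
      cases f 0 <;> cases g 0 <;> simp [hl]
    obtain ⟨h0, ht⟩ := (comp_inj' hlen).1 h
    have h0' : f 0 = g 0 := by
      cases hf : f 0 <;> cases hg : g 0 <;> simp_all
    rw [← Fin.cons_self_tail f, ← Fin.cons_self_tail g, h0', ih ht]

end Quiver.Path

namespace PathAlgebra

variable {k : Type u} [Field k] {V : Type v} [Quiver.{w} V] [Fintype V]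

open Quiver

/-- The trivial path that ends every word accounts for the extra factor `W`. -/
theorem ofPath_word_mem {a : V} (x y : Path a a) {W : Submodule k (PathAlgebra k V)}
    (hn : ofPath k (Path.nil : Path a a) ∈ W) (hx : ofPath k x ∈ W) (hy : ofPath k y ∈ W) (n : ℕ)
    (f : Fin n → Bool) : ofPath k (x.word y n f) ∈ W ^ (n + 1) := by
  induction n with
  | zero => simpa [Path.word] using hn
  | succ n ih =>
    rw [pow_succ', Path.word, ← ofPath_mul_ofPath]
    refine Submodule.mul_mem_mul ?_ (ih _)
    cases f 0 <;> simpa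

/-- Distinct words are distinct basis elements of `kQ`, so `W ^ (n + 1)` contains `2 ^ n`
independent elements. -/
theorem two_pow_le_finrank {a : V} {x y : Path a a} (hl : x.length = y.length) (hxy : x ≠ y)
    {W : Submodule k (PathAlgebra k V)} (hW : W.FG)
    (hn : ofPath k (Path.nil : Path a a) ∈ W) (hx : ofPath k x ∈ W) (hy : ofPath k y ∈ W) (n : ℕ) :
    2 ^ n ≤ Module.finrank k
      (∑ i ∈ Finset.range (n + 1 + 1), W ^ i : Submodule k (PathAlgebra k V)) := by
  set S : Submodule k (PathAlgebra k V) := ∑ i ∈ Finset.range (n + 1 + 1), W ^ i with hS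
  have hfg : S.FG := Finset.sum_induction _ Submodule.FG (fun _ _ => Submodule.FG.sup)
    Submodule.fg_bot fun i _ => hW.pow i
  have : Module.Finite k S := Module.Finite.iff_fg.2 hfg
  have hle : W ^ (n + 1) ≤ S :=
    Finset.single_le_sum_of_canonicallyOrdered (f := fun i => W ^ i) (by simp)
  let b : (Fin n → Bool) → S := fun f => ⟨_, hle (ofPath_word_mem x y hn hx hy n f)⟩
  have hb : LinearIndependent k b := by
    refine LinearIndependent.of_comp S.subtype ?_
    refine (pathBasis k (V := V)).linearIndependent.comp
      (fun f : Fin n → Bool => ⟨a, a, x.word y n f⟩) fun f g h => ?_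
    refine Path.word_injective hl hxy n ?_
    simpa using h
  simpa using hb.fintype_card_le_finrank

theorem tendsto_log_div_log_of_two_pow_le {D : ℕ → ℕ} (hD : ∀ n, 2 ^ n ≤ D (n + 1)) :
    Filter.Tendsto (fun n : ℕ => Real.log (D n) / Real.log n) Filter.atTop Filter.atTop := by
  have h1 : Filter.Tendsto (fun n : ℕ => (n : ℝ) / Real.log n) Filter.atTop Filter.atTop := by
    have h := (Real.isLittleO_log_id_atTop.tendsto_div_nhds_zero).comp
      (tendsto_natCast_atTop_atTop (R := ℝ))
    have h' : Filter.Tendsto (fun n : ℕ => Real.log n / (n : ℝ)) Filter.atTop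
        (nhdsWithin 0 (Set.Ioi 0)) := by
      refine tendsto_nhdsWithin_iff.2 ⟨h, ?_⟩
      filter_upwards [Filter.eventually_ge_atTop 2] with n hn
      have : (1 : ℝ) < n := by exact_mod_cast hn
      exact div_pos (Real.log_pos this) (by positivity)
    refine h'.inv_tendsto_nhdsGT_zero.congr fun n => ?_
    simp
  -- The factor `1 / 2` absorbs the shift of index: `m ≥ (m + 1) / 2` for `m ≥ 1`.
  refine Filter.tendsto_atTop_mono' _ ?_
    (h1.const_mul_atTop (show 0 < Real.log 2 / 2 by have := Real.log_pos one_lt_two; positivity))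
  filter_upwards [Filter.eventually_ge_atTop 2] with n hn
  obtain ⟨m, rfl⟩ := Nat.exists_eq_add_of_le' (show 1 ≤ n by omega)
  have hm : (1 : ℝ) ≤ m := by exact_mod_cast (show 1 ≤ m by omega)
  have hlog : 0 < Real.log ((m + 1 : ℕ) : ℝ) := Real.log_pos (by push_cast; linarith)
  rw [← mul_div_assoc]
  gcongr
  calc Real.log 2 / 2 * ((m + 1 : ℕ) : ℝ) ≤ m * Real.log 2 := by
        push_cast
        have := Real.log_pos one_lt_two
        nlinarith
    _ = Real.log ((2 : ℝ) ^ m) := by rw [Real.log_pow]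
    _ ≤ Real.log (D (m + 1)) := by
        refine Real.log_le_log (by positivity) ?_
        exact_mod_cast hD m

/-- If `kQ` has finite Gelfand–Kirillov dimension, then at most one simple cycle starts at each
vertex. -/
theorem uniqueSimpleCycles_of_gkDim_lt_top (h : gkDim k (PathAlgebra k V) < ⊤) :
    UniqueSimpleCycles V := by
  intro v p q hp hq
  by_contra hpq
  -- `p` and `q` may differ in length; the two products do not, as block-wise reading requires.
  have hxy : p.comp q ≠ q.comp p := fun h => hpq (hp.eq_of_comp_comm hq h)
  have hl : (p.comp q).length = (q.comp p).length := by simp [add_comm]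
  let W : Submodule k (PathAlgebra k V) := Submodule.span k
    {ofPath k (Path.nil : Path v v), ofPath k (p.comp q), ofPath k (q.comp p)}
  have hW : W.FG := Submodule.fg_span (by simp)
  have : FiniteDimensional k W := Module.Finite.iff_fg.2 hW
  have hlim := tendsto_log_div_log_of_two_pow_le
    (D := fun n => Module.finrank k (∑ i ∈ Finset.range (n + 1), W ^ i :
      Submodule k (PathAlgebra k V)))
    (two_pow_le_finrank hl hxy hW (Submodule.subset_span (by simp))
      (Submodule.subset_span (by simp)) (Submodule.subset_span (by simp)))
  have htop : Filter.limsup (fun n : ℕ =>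
      ((Real.log (Module.finrank k (∑ i ∈ Finset.range (n + 1), W ^ i :
        Submodule k (PathAlgebra k V))) / Real.log n : ℝ) : EReal)) Filter.atTop = ⊤ :=
    (EReal.tendsto_coe_nhds_top_iff.2 hlim).limsup_eq
  refine h.not_ge ?_
  rw [← htop, gkDim]
  exact le_iSup₂ (f := fun (W : Submodule k (PathAlgebra k V)) (_ : FiniteDimensional k W) =>
    Filter.limsup (fun n : ℕ =>
      ((Real.log (Module.finrank k (∑ i ∈ Finset.range (n + 1), W ^ i :
        Submodule k (PathAlgebra k V))) / Real.log n : ℝ) : EReal)) Filter.atTop) W this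

end PathAlgebra

/-! ### Torsion elements and the quotient category -/

namespace Gr

noncomputable section

variable {k : Type u} [Field k] {V : Type v} [Quiver.{w} V] [Fintype V]

open MulOpposite PathAlgebra

/-- `N` is a submodule of `M` with torsion quotient. -/
def IsCotorsion (M : Gr.{u, v, w} k V) (N : Submodule (PathAlgebra k V)ᵐᵒᵖ M) : Prop :=
  ∀ y : M, ∃ n : ℕ, ∀ i ≥ n, ∀ a ∈ grading k (V := V) i, op a • y ∈ N

theorem IsCotorsion.mono {M : Gr.{u, v, w} k V} {N N' : Submodule (PathAlgebra k V)ᵐᵒᵖ M}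
    (h : IsCotorsion M N) (hle : N ≤ N') : IsCotorsion M N' := fun y => by
  obtain ⟨n, hn⟩ := h y
  exact ⟨n, fun i hi a ha => hle (hn i hi a ha)⟩

/-! ### Torsion elements -/

section Elements

variable {M N : Gr.{u, v, w} k V}

theorem smul_smul_op (m : M) (a b : PathAlgebra k V) : op b • op a • m = op (a * b) • m := by
  rw [smul_smul, op_mul]

theorem smul_base (m : M) (c : k) (a : PathAlgebra k V) : op (c • a) • m = c • op a • m := by
  rw [op_smul, smul_assoc]

theorem smul_base_eq (m : M) (c : k) : c • m = op (c • (1 : PathAlgebra k V)) • m := by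
  rw [smul_base, op_one, one_smul]

theorem isTorsionElem_zero : M.IsTorsionElem 0 := ⟨0, fun _ _ _ _ => smul_zero _⟩

theorem isTorsionElem_add {x y : M} (hx : M.IsTorsionElem x) (hy : M.IsTorsionElem y) :
    M.IsTorsionElem (x + y) := by
  obtain ⟨n, hn⟩ := hx
  obtain ⟨n', hn'⟩ := hy
  refine ⟨n + n', fun i hi a ha => ?_⟩
  rw [smul_add, hn i (by omega) a ha, hn' i (by omega) a ha, add_zero]

theorem isTorsionElem_base_smul {x : M} (hx : M.IsTorsionElem x) (c : k) :
    M.IsTorsionElem (c • x) := by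
  obtain ⟨n, hn⟩ := hx
  refine ⟨n, fun i hi a ha => ?_⟩
  rw [smul_base_eq, smul_smul_op, smul_mul_assoc, one_mul]
  exact hn i hi _ (Submodule.smul_mem _ c ha)

theorem isTorsionElem_smul {x : M} (hx : M.IsTorsionElem x) (a : PathAlgebra k V) :
    M.IsTorsionElem (op a • x) := by
  obtain ⟨n, hn⟩ := hx
  induction a using path_induction with
  | path a b p =>
    refine ⟨n, fun i hi c hc => ?_⟩
    rw [smul_smul_op]
    exact hn (p.length + i) (by omega) _ (SetLike.mul_mem_graded (ofPath_mem k p) hc)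
  | zero => simpa using isTorsionElem_zero
  | add a b ha hb => rw [MulOpposite.op_add, add_smul]; exact isTorsionElem_add ha hb
  | smul c a ha => rw [smul_base]; exact isTorsionElem_base_smul ha c

theorem isTorsionElem_map {x : M} (hx : M.IsTorsionElem x) (f : M ⟶ N) :
    N.IsTorsionElem (f.lin x) := by
  obtain ⟨n, hn⟩ := hx
  exact ⟨n, fun i hi a ha => by rw [← map_smul, hn i hi a ha, map_zero]⟩

theorem isTorsionElem_of_injective {x : M} (f : M ⟶ N) (hf : Function.Injective f.lin)
    (hx : N.IsTorsionElem (f.lin x)) : M.IsTorsionElem x := by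
  obtain ⟨n, hn⟩ := hx
  exact ⟨n, fun i hi a ha => hf (by rw [map_smul, hn i hi a ha, map_zero])⟩

theorem isTorsionElem_component {x : M} (hx : M.IsTorsionElem x) (i : ℤ) :
    M.IsTorsionElem (M.component i x) := by
  obtain ⟨n, hn⟩ := hx
  refine ⟨n, fun j hj a ha => ?_⟩
  have := M.component_smul ha (i + j) x
  rw [hn j hj a ha, map_zero, add_sub_cancel_right] at this
  exact this.symm

theorem isTorsionElem_finsetSum {ι : Type*} (s : Finset ι) {f : ι → M}
    (h : ∀ i ∈ s, M.IsTorsionElem (f i)) : M.IsTorsionElem (∑ i ∈ s, f i) :=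
  Finset.sum_induction _ _ (fun _ _ => isTorsionElem_add) isTorsionElem_zero h

theorem sum_vertices_smul (m : M) :
    m = ∑ v : V, op (ofPath k (Quiver.Path.nil : Quiver.Path v v)) • m := by
  conv_lhs => rw [← one_smul (PathAlgebra k V)ᵐᵒᵖ m, ← op_one, one_eq]
  rw [Finset.op_sum, Finset.sum_smul]

/-- A module that is not torsion has a homogeneous element, supported at a vertex, that is not
torsion. -/
theorem exists_not_isTorsionElem (N : Submodule (PathAlgebra k V)ᵐᵒᵖ M) (hN : M.IsHomogeneous N)
    {x : M} (hx : x ∈ N) (h : ¬ M.IsTorsionElem x) :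
    ∃ (i : ℤ) (v : V) (m : M), m ∈ N ∧ m ∈ M.deg i ∧
      op (ofPath k (Quiver.Path.nil : Quiver.Path v v)) • m = m ∧ ¬ M.IsTorsionElem m := by
  classical
  -- An element `x` is the finite sum of the pieces `xᵢ e_v`; if all of these are torsion, so is
  -- `x`.
  by_contra! hcon
  refine h ?_
  have hsum : x = ∑ i ∈ (M.decomp.symm x).support, M.component i x := by
    conv_lhs => rw [← M.decomp.apply_symm_apply x]
    rw [GrMod.decomp_apply, DirectSum.coeLinearMap_eq_dfinsuppSum]
    rfl
  rw [hsum]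
  refine isTorsionElem_finsetSum _ fun i _ => ?_
  rw [sum_vertices_smul (M.component i x)]
  refine isTorsionElem_finsetSum _ fun v _ => ?_
  refine hcon i v _ (N.smul_mem _ (hN x hx i)) ?_ ?_
  · have := M.smul_mem_deg (M.component_mem i x)
      (ofPath_mem k (Quiver.Path.nil : Quiver.Path v v))
    simpa using this
  · rw [smul_smul_op, ofPath_mul_ofPath, Quiver.Path.comp_nil]

end Elements

/-! ### Isomorphisms and simple objects in `QGr kQ` -/

section Quotient

variable [∀ a b : V, Finite (a ⟶ b)] {M N : Gr.{u, v, w} k V}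

/-- If `m p` is torsion for all paths `p` of length `n`, then `m` is torsion. -/
theorem isTorsionElem_of_paths (n : ℕ) (m : M)
    (h : ∀ (a b : V) (p : Quiver.Path a b), p.length = n →
      M.IsTorsionElem (op (ofPath k p) • m)) : M.IsTorsionElem m := by
  refine isTorsionElem_of_tail M n m fun i hi a ha => ?_
  induction ha using Submodule.span_induction with
  | mem x hx =>
    obtain ⟨a, b, p, rfl, rfl⟩ := hx
    obtain ⟨c, p₁, p₂, rfl, hl⟩ := p.exists_eq_comp_of_le_length hi
    rw [← ofPath_mul_ofPath, ← smul_smul_op]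
    exact isTorsionElem_smul (h _ _ p₁ hl) _
  | zero => simpa using isTorsionElem_zero
  | add x y _ _ hx hy => rw [MulOpposite.op_add, add_smul]; exact isTorsionElem_add hx hy
  | smul c x _ hx => rw [smul_base]; exact isTorsionElem_base_smul hx c

theorem tors_kernel_iff (f : M ⟶ N) :
    Tors k V (kernel f) ↔ ∀ x, f.lin x = 0 → M.IsTorsionElem x := by
  refine ((Tors k V).prop_iff_of_iso
    (IsLimit.conePointUniqueUpToIso (kernelIsKernel f) (GrMod.kernelIsLimit f))).trans ?_
  constructor
  · intro h x hx
    exact isTorsionElem_map (h ⟨x, hx⟩) (GrMod.subι _ (GrMod.isHomogeneous_ker f))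
  · intro h x
    exact isTorsionElem_of_injective (GrMod.subι _ (GrMod.isHomogeneous_ker f))
      Subtype.val_injective (h x.1 x.2)

theorem tors_cokernel_iff (f : M ⟶ N) :
    Tors k V (cokernel f) ↔ IsCotorsion N (LinearMap.range f.lin) := by
  refine ((Tors k V).prop_iff_of_iso
    (IsColimit.coconePointUniqueUpToIso (cokernelIsCokernel f) (GrMod.cokernelIsColimit f))).trans ?_
  constructor
  · intro h y
    obtain ⟨n, hn⟩ := h (Submodule.Quotient.mk y)
    exact ⟨n, fun i hi a ha => (Submodule.Quotient.mk_eq_zero _).1 (hn i hi a ha)⟩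
  · intro h y
    obtain ⟨y, rfl⟩ := Submodule.Quotient.mk_surjective _ y
    obtain ⟨n, hn⟩ := h y
    exact ⟨n, fun i hi a ha => (Submodule.Quotient.mk_eq_zero _).2 (hn i hi a ha)⟩

theorem isoModSerre_iff (f : M ⟶ N) : (Tors k V).isoModSerre f ↔
    (∀ x, f.lin x = 0 → M.IsTorsionElem x) ∧ IsCotorsion N (LinearMap.range f.lin) := by
  rw [ObjectProperty.isoModSerre_iff, ObjectProperty.monoModSerre_iff,
    ObjectProperty.epiModSerre_iff, tors_kernel_iff, tors_cokernel_iff]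

theorem isIso_proj_map_iff (f : M ⟶ N) : IsIso ((QGr.proj k V).map f) ↔
    (∀ x, f.lin x = 0 → M.IsTorsionElem x) ∧ IsCotorsion N (LinearMap.range f.lin) := by
  rw [ObjectProperty.SerreClassLocalization.isIso_map_iff (QGr.proj k V) (Tors k V),
    isoModSerre_iff]

theorem isZero_proj_obj_iff : IsZero ((QGr.proj k V).obj M) ↔ Tors k V M :=
  ObjectProperty.SerreClassLocalization.isZero_obj_iff (QGr.proj k V) (Tors k V) M

/-- The morphism factors through its image, a torsion module, which becomes zero in the quotient. -/
theorem proj_map_eq_zero (f : M ⟶ N) (h : ∀ x, N.IsTorsionElem (f.lin x)) :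
    (QGr.proj k V).map f = 0 := by
  let I := N.sub _ (GrMod.isHomogeneous_range f)
  let g : M ⟶ I := ⟨f.lin.rangeRestrict, fun h => f.map_deg h⟩
  have hI : Tors k V I := by
    rintro ⟨_, x, rfl⟩
    exact isTorsionElem_of_injective (GrMod.subι _ (GrMod.isHomogeneous_range f))
      Subtype.val_injective (h x)
  have hfac : f = g ≫ GrMod.subι _ (GrMod.isHomogeneous_range f) := rfl
  rw [hfac, Functor.map_comp, (isZero_proj_obj_iff.2 hI).eq_of_tgt ((QGr.proj k V).map g) 0,
    zero_comp]

/-- A module that is not torsion, and whose homogeneous submodules are torsion or have torsion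
quotient, is simple in the quotient category. -/
theorem simple_proj_obj (hM : ¬ Tors k V M)
    (h : ∀ N : Submodule (PathAlgebra k V)ᵐᵒᵖ M, M.IsHomogeneous N →
      (∃ x ∈ N, ¬ M.IsTorsionElem x) → IsCotorsion M N) :
    Simple ((QGr.proj k V).obj M) := by
  refine ⟨fun {Y} f _ => ⟨?_, fun hf => ?_⟩⟩
  · rintro _ rfl
    refine hM (isZero_proj_obj_iff.1 ?_)
    rw [IsZero.iff_id_eq_zero, ← IsIso.inv_hom_id (0 : Y ⟶ (QGr.proj k V).obj M), comp_zero]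
  · have := Localization.essSurj (QGr.proj k V) (Tors k V).isoModSerre
    let e := (QGr.proj k V).objObjPreimageIso Y
    -- Up to isomorphisms in the quotient, the subobject `f` is the image of a genuine morphism
    -- `φ.f` into `M`. Its kernel is torsion because `f` is mono; its range is a non-torsion
    -- homogeneous submodule because `f ≠ 0`.
    obtain ⟨φ, hφ⟩ := Localization.exists_rightFraction (QGr.proj k V) (Tors k V).isoModSerre
      (e.hom ≫ f)
    have hs := Localization.inverts (QGr.proj k V) (Tors k V).isoModSerre φ.s φ.hs
    have hmap : (QGr.proj k V).map φ.f = (QGr.proj k V).map φ.s ≫ e.hom ≫ f := by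
      rw [hφ, MorphismProperty.RightFraction.map_s_comp_map]
    have hne : (QGr.proj k V).map φ.f ≠ 0 := by
      intro h0
      rw [h0] at hmap
      refine hf ?_
      rw [← cancel_epi e.hom, ← cancel_epi ((QGr.proj k V).map φ.s), ← hmap]
      simp
    have hmono : Mono ((QGr.proj k V).map φ.f) := by rw [hmap]; infer_instance
    have hiso : IsIso ((QGr.proj k V).map φ.f) := by
      rw [isIso_proj_map_iff]
      constructor
      · rw [← tors_kernel_iff]
        exact (ObjectProperty.SerreClassLocalization.mono_map_iff (QGr.proj k V) (Tors k V) _).1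
          hmono
      · refine h _ (GrMod.isHomogeneous_range _) ?_
        by_contra! hcon
        exact hne (proj_map_eq_zero _ fun x => hcon _ ⟨x, rfl⟩)
    have h2 : IsIso (e.hom ≫ f) := by
      rw [hmap] at hiso
      exact IsIso.of_isIso_comp_left ((QGr.proj k V).map φ.s) _
    exact IsIso.of_isIso_comp_left e.hom f

/-- If a module is simple in the quotient category, then its homogeneous submodules that are not
torsion have torsion quotient. -/
theorem isCotorsion_of_simple [Simple ((QGr.proj k V).obj M)]
    (N : Submodule (PathAlgebra k V)ᵐᵒᵖ M) (hN : M.IsHomogeneous N) {x : M} (hx : x ∈ N)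
    (h : ¬ M.IsTorsionElem x) : IsCotorsion M N := by
  have hmono : Mono ((QGr.proj k V).map (GrMod.subι N hN)) := by
    refine (ObjectProperty.SerreClassLocalization.mono_map_iff (QGr.proj k V) (Tors k V) _).2 ?_
    refine (tors_kernel_iff _).2 fun y hy => ?_
    rw [show y = 0 from Subtype.ext hy]
    exact isTorsionElem_zero
  have hne : (QGr.proj k V).map (GrMod.subι N hN) ≠ 0 := by
    intro h0
    have hz : IsZero ((QGr.proj k V).obj (M.sub N hN)) := by
      rw [IsZero.iff_id_eq_zero, ← cancel_mono ((QGr.proj k V).map (GrMod.subι N hN)), h0]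
      simp
    exact h (isTorsionElem_map (isZero_proj_obj_iff.1 hz ⟨x, hx⟩) (GrMod.subι N hN))
  have hiso := isIso_of_mono_of_nonzero hne
  refine ((isIso_proj_map_iff _).1 hiso).2.mono ?_
  rintro _ ⟨y, rfl⟩
  exact y.2

/-- Two modules are isomorphic in the quotient category if they contain homogeneous elements of
the same degree that have the same annihilator up to torsion and generate submodules with torsion
quotient. -/
theorem nonempty_iso_of_generators {d : ℤ} {x : M} {y : N} (hx : x ∈ M.deg d) (hy : y ∈ N.deg d)
    (h : ∀ a : PathAlgebra k V, M.IsTorsionElem (op a • x) ↔ N.IsTorsionElem (op a • y))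
    (hxM : IsCotorsion M (Submodule.span _ {x})) (hyN : IsCotorsion N (Submodule.span _ {y})) :
    Nonempty ((QGr.proj k V).obj M ≅ (QGr.proj k V).obj N) := by
  -- The submodule `G` generated by `(x, y)` is the roof. An element `(x a, y a)` killed by one
  -- projection has its other coordinate torsion by `h`, so both projections have torsion kernel.
  let z : M.prod N := (x, y)
  have hz : (M.prod N).IsHomogeneous (Submodule.span (PathAlgebra k V)ᵐᵒᵖ {z}) :=
    GrMod.isHomogeneous_span _ _ (by rintro _ rfl; exact ⟨d, hx, hy⟩)
  let G := (M.prod N).sub _ hz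
  let f : G ⟶ M := GrMod.subι _ hz ≫ (GrMod.binaryBicone M N).fst
  let g : G ⟶ N := GrMod.subι _ hz ≫ (GrMod.binaryBicone M N).snd
  have hG : ∀ t : G, ∃ a : PathAlgebra k V, f.lin t = op a • x ∧ g.lin t = op a • y := by
    rintro ⟨t, ht⟩
    obtain ⟨a, rfl⟩ := Submodule.mem_span_singleton.1 ht
    exact ⟨a.unop, rfl, rfl⟩
  have htors : ∀ t : G, M.IsTorsionElem (f.lin t) → N.IsTorsionElem (g.lin t) →
      G.IsTorsionElem t := by
    rintro t ⟨n, hn⟩ ⟨n', hn'⟩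
    refine ⟨n + n', fun i hi a ha => Subtype.ext (Prod.ext ?_ ?_)⟩
    · exact hn i (by omega) a ha
    · exact hn' i (by omega) a ha
  have hzG : z ∈ Submodule.span (PathAlgebra k V)ᵐᵒᵖ {z} := Submodule.mem_span_singleton_self z
  have hf : IsIso ((QGr.proj k V).map f) := by
    rw [isIso_proj_map_iff]
    refine ⟨fun t ht => ?_, hxM.mono ?_⟩
    · obtain ⟨a, ha, hb⟩ := hG t
      have h0 : M.IsTorsionElem (f.lin t) := by rw [ht]; exact isTorsionElem_zero
      refine htors t h0 ?_
      rw [hb, ← h, ← ha]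
      exact h0
    · rw [Submodule.span_singleton_le_iff_mem]
      exact ⟨⟨z, hzG⟩, rfl⟩
  have hg : IsIso ((QGr.proj k V).map g) := by
    rw [isIso_proj_map_iff]
    refine ⟨fun t ht => ?_, hyN.mono ?_⟩
    · obtain ⟨a, ha, hb⟩ := hG t
      have h0 : N.IsTorsionElem (g.lin t) := by rw [ht]; exact isTorsionElem_zero
      refine htors t ?_ h0
      rw [ha, h, ← hb]
      exact h0
    · rw [Submodule.span_singleton_le_iff_mem]
      exact ⟨⟨z, hzG⟩, rfl⟩
  exact ⟨(asIso ((QGr.proj k V).map f)).symm ≪≫ asIso ((QGr.proj k V).map g)⟩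

/-- An isomorphism in the quotient category is represented by a roof of morphisms with torsion
kernels and cokernels. -/
theorem exists_roof_of_iso (e : (QGr.proj k V).obj M ≅ (QGr.proj k V).obj N) :
    ∃ (X : Gr.{u, v, w} k V) (s : X ⟶ M) (f : X ⟶ N), IsCotorsion M (LinearMap.range s.lin) ∧
      ∀ x, f.lin x = 0 → X.IsTorsionElem x := by
  obtain ⟨φ, hφ⟩ := Localization.exists_rightFraction (QGr.proj k V) (Tors k V).isoModSerre e.hom
  have hs := Localization.inverts (QGr.proj k V) (Tors k V).isoModSerre φ.s φ.hs
  have hmap : (QGr.proj k V).map φ.f = (QGr.proj k V).map φ.s ≫ e.hom := by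
    rw [hφ, MorphismProperty.RightFraction.map_s_comp_map]
  have hf : IsIso ((QGr.proj k V).map φ.f) := by rw [hmap]; infer_instance
  exact ⟨_, φ.s, φ.f, ((isIso_proj_map_iff _).1 hs).2, ((isIso_proj_map_iff _).1 hf).1⟩

end Quotient

end

end Gr

/-! ### Elements generating a cyclic point module up to torsion -/

namespace PathAlgebra

noncomputable section

open Quiver

variable (k : Type u) [Field k] {V : Type v} [Quiver.{w} V]

/-- The span of the paths that do not start at `v` or have no way back to `v`. -/
def nonReturning (v : V) : Submodule k (PathAlgebra k V) :=
  Submodule.span k {x | ∃ (a b : V) (p : Path a b), x = ofPath k p ∧ ¬ (a = v ∧ Nonempty (Path b v))}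

variable {k}

/-- `nonReturning k v` is spanned by basis vectors, and a returning path is not among them. -/
theorem ofPath_notMem_nonReturning {v u : V} (p : Path v u) (q : Path u v) :
    ofPath k p ∉ nonReturning k v := by
  have hS : {x : PathAlgebra k V | ∃ (a b : V) (p : Path a b), x = ofPath k p ∧
      ¬ (a = v ∧ Nonempty (Path b v))} =
      pathBasis k '' {r | ¬ (r.1 = v ∧ Nonempty (Path r.2.1 v))} := by
    ext x
    constructor
    · rintro ⟨a, b, p, rfl, h⟩
      exact ⟨⟨a, b, p⟩, h, rfl⟩
    · rintro ⟨⟨a, b, p⟩, h, rfl⟩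
      exact ⟨a, b, p, rfl, h⟩
  rw [nonReturning, hS]
  refine (pathBasis k (V := V)).linearIndependent.notMem_span_image ?_
  exact fun h => h ⟨rfl, ⟨q⟩⟩

/-- Prolonging a path without a way back never creates one, so `nonReturning k v` is a right ideal.
-/
theorem mul_mem_nonReturning {v : V} {x : PathAlgebra k V} (hx : x ∈ nonReturning k v)
    (y : PathAlgebra k V) : x * y ∈ nonReturning k v := by
  induction hx using Submodule.span_induction with
  | mem x h =>
    obtain ⟨a, b, p, rfl, h⟩ := h
    induction y using path_induction with
    | path b' c q =>
      by_cases hb : b' = b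
      · subst hb
        rw [ofPath_mul_ofPath]
        exact Submodule.subset_span ⟨a, c, _, rfl, fun h' => h ⟨h'.1, h'.2.map q.comp⟩⟩
      · rw [ofPath_mul_ofPath_of_ne k p q hb]
        exact Submodule.zero_mem _
    | zero => rw [aux_mul_zero]; exact Submodule.zero_mem _
    | add x y hx hy => rw [aux_mul_add]; exact Submodule.add_mem _ hx hy
    | smul c x hx => rw [aux_mul_smul]; exact Submodule.smul_mem _ c hx
  | zero => rw [aux_zero_mul]; exact Submodule.zero_mem _
  | add x y _ _ hx hy => rw [aux_add_mul]; exact Submodule.add_mem _ hx hy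
  | smul c x _ hx => rw [aux_smul_mul]; exact Submodule.smul_mem _ c hx

/-- In each degree only one path from `v` has a way back to `v`. -/
theorem exists_sub_mem_nonReturning (H : UniqueSimpleCycles V) {v u : V} (p : Path v u)
    (q : Path u v) {a : PathAlgebra k V} (ha : a ∈ grading k p.length) :
    ∃ c : k, a - c • ofPath k p ∈ nonReturning k v := by
  induction ha using Submodule.span_induction with
  | mem x h =>
    obtain ⟨a, b, r, hr, rfl⟩ := h
    by_cases hab : a = v ∧ Nonempty (Path b v)
    · obtain ⟨rfl, ⟨s⟩⟩ := hab
      obtain ⟨⟩ := H.path_unique _ r p s q hr rfl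
      exact ⟨1, by simp⟩
    · refine ⟨0, ?_⟩
      rw [zero_smul, sub_zero]
      exact Submodule.subset_span ⟨a, b, r, rfl, hab⟩
  | zero => exact ⟨0, by simp⟩
  | add x y _ _ hx hy =>
    obtain ⟨c, hc⟩ := hx
    obtain ⟨d, hd⟩ := hy
    refine ⟨c + d, ?_⟩
    rw [add_smul, add_sub_add_comm]
    exact Submodule.add_mem _ hc hd
  | smul b x _ hx =>
    obtain ⟨c, hc⟩ := hx
    refine ⟨b * c, ?_⟩
    rw [mul_smul, ← smul_sub]
    exact Submodule.smul_mem _ b hc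

end

end PathAlgebra

namespace Gr

noncomputable section

variable {k : Type u} [Field k] {V : Type v} [Quiver.{w} V] [Fintype V]

open MulOpposite PathAlgebra Quiver

/-- Reduces questions about `m a` to the homogeneous parts of `a`, where only one returning path can
occur. -/
theorem component_op_smul {M : Gr.{u, v, w} k V} {d : ℤ} {m : M} (hm : m ∈ M.deg d)
    (a : PathAlgebra k V) (n : ℕ) :
    M.component (d + n) (op a • m) =
      op (DirectSum.decompose (grading k (V := V)) a n : PathAlgebra k V) • m := by
  induction a using DirectSum.Decomposition.inductionOn (grading k (V := V)) with
  | zero => simp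
  | @homogeneous i a =>
    have h := M.smul_mem_deg hm a.2
    by_cases hin : i = n
    · subst hin
      rw [M.component_of_mem h, DirectSum.decompose_of_mem_same _ a.2]
    · rw [M.component_of_mem_ne (by omega) h, DirectSum.decompose_of_mem_ne _ a.2 hin]
      simp
  | add a b ha hb =>
    rw [MulOpposite.op_add, add_smul, map_add, ha, hb, ← add_smul, ← MulOpposite.op_add,
      DirectSum.decompose_add]
    rfl

/-- Up to torsion, `m` is a homogeneous generator of degree `d` of the cyclic point module at
`v`: it is supported at `v`, and `m p` is torsion exactly for the paths `p` with no way back. -/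
structure IsCyclicGenerator (M : Gr.{u, v, w} k V) (v : V) (d : ℤ) (m : M) : Prop where
  recurrent : IsRecurrent v
  mem_deg : m ∈ M.deg d
  vertex_smul : op (ofPath k (Path.nil : Path v v)) • m = m
  torsion_iff : ∀ {u : V} (p : Path v u),
    M.IsTorsionElem (op (ofPath k p) • m) ↔ IsEmpty (Path u v)

theorem path_smul_eq_zero {M : Gr.{u, v, w} k V} {m : M} {v a b : V}
    (hm : op (ofPath k (Path.nil : Path v v)) • m = m) (p : Path a b) (h : a ≠ v) :
    op (ofPath k p) • m = 0 := by
  rw [← hm, smul_smul_op, ofPath_mul_ofPath_of_ne k _ _ h, MulOpposite.op_zero, zero_smul]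

namespace IsCyclicGenerator

variable {M N : Gr.{u, v, w} k V} {v : V} {d : ℤ} {m : M}

theorem isTorsionElem_of_mem (hm : IsCyclicGenerator M v d m) {a : PathAlgebra k V}
    (ha : a ∈ nonReturning k v) : M.IsTorsionElem (op a • m) := by
  induction ha using Submodule.span_induction with
  | mem x h =>
    obtain ⟨a, b, p, rfl, h⟩ := h
    by_cases hav : a = v
    · subst hav
      rw [hm.torsion_iff, ← not_nonempty_iff]
      exact fun h' => h ⟨rfl, h'⟩
    · rw [path_smul_eq_zero hm.vertex_smul p hav]
      exact isTorsionElem_zero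
  | zero => simpa using isTorsionElem_zero
  | add x y _ _ hx hy => rw [MulOpposite.op_add, add_smul]; exact isTorsionElem_add hx hy
  | smul c x _ hx => rw [smul_base]; exact isTorsionElem_base_smul hx c

theorem not_isTorsionElem_path (hm : IsCyclicGenerator M v d m) {u : V} (p : Path v u)
    (q : Path u v) : ¬ M.IsTorsionElem (op (ofPath k p) • m) := by
  rw [hm.torsion_iff, not_isEmpty_iff]
  exact ⟨q⟩

theorem not_isTorsionElem (hm : IsCyclicGenerator M v d m) : ¬ M.IsTorsionElem m := by
  rw [← hm.vertex_smul]
  exact hm.not_isTorsionElem_path .nil .nil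

theorem isHomogeneous_span (hm : IsCyclicGenerator M v d m) :
    M.IsHomogeneous (Submodule.span (PathAlgebra k V)ᵐᵒᵖ {m}) :=
  GrMod.isHomogeneous_span _ _ (by rintro _ rfl; exact ⟨d, hm.mem_deg⟩)

/-- Cyclic generators travel along the cycle: as `p` and `q` join `u` and `v` both ways, a vertex
leads back to `u` exactly when it leads back to `v`. -/
theorem smul_path (hm : IsCyclicGenerator M v d m) {u : V} (p : Path v u) (q : Path u v) :
    IsCyclicGenerator M u (d + p.length) (op (ofPath k p) • m) where
  recurrent := isRecurrent_of_path hm.recurrent p q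
  mem_deg := M.smul_mem_deg hm.mem_deg (ofPath_mem k p)
  vertex_smul := by rw [smul_smul_op, ofPath_mul_ofPath, Path.comp_nil]
  torsion_iff {x} r := by
    rw [smul_smul_op, ofPath_mul_ofPath, hm.torsion_iff]
    exact ⟨fun h => ⟨fun s => h.false (s.comp q)⟩, fun h => ⟨fun s => h.false (s.comp p)⟩⟩

/-- `m a` is torsion if and only if only paths without a way back occur in `a`. -/
theorem isTorsionElem_iff (H : UniqueSimpleCycles V) (hm : IsCyclicGenerator M v d m)
    {a : PathAlgebra k V} : M.IsTorsionElem (op a • m) ↔ a ∈ nonReturning k v := by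
  classical
  refine ⟨fun h => ?_, hm.isTorsionElem_of_mem⟩
  -- Work in each degree: the part of `a` of degree `n` is `c p` modulo `nonReturning k v`, and
  -- since `m p` is not torsion, `c = 0`.
  rw [← DirectSum.sum_support_decompose (grading k (V := V)) a]
  refine Submodule.sum_mem _ fun n _ => ?_
  have hn := isTorsionElem_component h (d + n)
  rw [component_op_smul hm.mem_deg] at hn
  obtain ⟨u, p, rfl, ⟨q⟩⟩ := hm.recurrent.exists_path n
  set b : PathAlgebra k V := (DirectSum.decompose (grading k (V := V)) a p.length).1
  obtain ⟨c, hc⟩ := exists_sub_mem_nonReturning H p q (a := b) (Subtype.coe_prop _)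
  have hc0 : c = 0 := by
    by_contra hc0
    refine hm.not_isTorsionElem_path p q ?_
    have h1 := isTorsionElem_add hn
      (isTorsionElem_base_smul (hm.isTorsionElem_of_mem hc) (-1))
    have h2 := isTorsionElem_base_smul h1 c⁻¹
    convert h2 using 1
    rw [MulOpposite.op_sub, sub_smul, smul_base]
    simp [smul_smul, hc0]
  simpa [hc0] using hc

end IsCyclicGenerator

/-! ### Cyclic generators and objects of `QGr kQ` -/

section Quotient

variable [∀ a b : V, Finite (a ⟶ b)] {M N : Gr.{u, v, w} k V} {v : V} {d : ℤ} {m : M}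

/-- A submodule has torsion quotient if it has torsion quotient inside a larger submodule with
torsion quotient. -/
theorem IsCotorsion.trans {N N' : Submodule (PathAlgebra k V)ᵐᵒᵖ M} (h : IsCotorsion M N')
    (hN : M.IsHomogeneous N)
    (h' : ∀ y ∈ N', (M.quot N hN).IsTorsionElem ((GrMod.quotπ N hN).lin y)) :
    IsCotorsion M N := by
  intro y
  obtain ⟨n, hn⟩ := h y
  obtain ⟨n', hn'⟩ := isTorsionElem_of_tail (M.quot N hN) n ((GrMod.quotπ N hN).lin y)
    fun i hi a ha => by
      rw [← map_smul]
      exact h' _ (hn i hi a ha)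
  exact ⟨n', fun i hi a ha => (Submodule.Quotient.mk_eq_zero _).1 (hn' i hi a ha)⟩

namespace IsCyclicGenerator

/-- Every path of the length of `p`, except `p` itself, sends `m` to a torsion element. Hence `m` is
torsion modulo the submodule generated by `m p`. -/
theorem isCotorsion_smul_path (H : UniqueSimpleCycles V) (hm : IsCyclicGenerator M v d m)
    (h : IsCotorsion M (Submodule.span _ {m})) {u : V} (p : Path v u) (q : Path u v) :
    IsCotorsion M (Submodule.span _ {op (ofPath k p) • m}) := by
  refine h.trans (hm.smul_path p q).isHomogeneous_span fun y hy => ?_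
  obtain ⟨b, rfl⟩ := Submodule.mem_span_singleton.1 hy
  rw [map_smul, ← op_unop b]
  refine isTorsionElem_smul (isTorsionElem_of_paths p.length _ fun a c r hr => ?_) _
  rw [← map_smul]
  by_cases ha : a = v
  · subst ha
    rcases isEmpty_or_nonempty (Path c a) with he | ⟨⟨s⟩⟩
    · exact isTorsionElem_map ((hm.torsion_iff r).2 he) _
    · obtain ⟨⟩ := H.path_unique _ r p s q hr rfl
      have h0 : (GrMod.quotπ _ (hm.smul_path p q).isHomogeneous_span).lin
          (op (ofPath k p) • m) = 0 :=
        (Submodule.Quotient.mk_eq_zero _).2 (Submodule.mem_span_singleton_self _)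
      rw [h0]
      exact isTorsionElem_zero
  · rw [path_smul_eq_zero hm.vertex_smul r ha, map_zero]
    exact isTorsionElem_zero

/-- A non-torsion homogeneous submodule meets the span of `m` in some `m b` with `b` homogeneous and
equal to `c p` modulo `nonReturning k v`, `c ≠ 0`. Multiplying further removes the error and leaves
`m (p p')` in the submodule. -/
theorem simple (H : UniqueSimpleCycles V) (hm : IsCyclicGenerator M v d m)
    (h : IsCotorsion M (Submodule.span _ {m})) : Simple ((QGr.proj k V).obj M) := by
  classical
  refine simple_proj_obj (fun ht => hm.not_isTorsionElem (ht m)) ?_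
  rintro N hN ⟨x, hx, hxt⟩
  obtain ⟨n, hn⟩ := h x
  obtain ⟨y, r, hr, hyt⟩ : ∃ (y : PathAlgebra k V) (_ : y ∈ grading k n), op y • x ∈ N ∧
      ¬ M.IsTorsionElem (op y • x) := by
    by_contra! hcon
    exact hxt (isTorsionElem_of_paths n x fun a b p hp =>
      hcon _ (hp ▸ ofPath_mem k p) (N.smul_mem _ hx))
  obtain ⟨a, ha⟩ := Submodule.mem_span_singleton.1 (hn n le_rfl y r)
  rw [← op_unop a] at ha
  rw [← ha] at hr hyt
  rw [hm.isTorsionElem_iff H] at hyt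
  obtain ⟨j, hj⟩ : ∃ j : ℕ, (DirectSum.decompose (grading k (V := V)) a.unop j :
      PathAlgebra k V) ∉ nonReturning k v := by
    by_contra! hcon
    refine hyt ?_
    rw [← DirectSum.sum_support_decompose (grading k (V := V)) a.unop]
    exact Submodule.sum_mem _ fun i _ => hcon i
  have hbN := hN _ hr (d + j)
  rw [component_op_smul hm.mem_deg] at hbN
  obtain ⟨u, p, rfl, ⟨q⟩⟩ := hm.recurrent.exists_path j
  set b : PathAlgebra k V := (DirectSum.decompose (grading k (V := V)) a.unop p.length).1
  obtain ⟨c, hc⟩ := exists_sub_mem_nonReturning H p q (a := b) (Subtype.coe_prop _)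
  have hc0 : c ≠ 0 := by
    rintro rfl
    exact hj (by simpa using hc)
  -- The error `m (b - c p)` is torsion, so a returning path `p'` of length `s` annihilates it.
  obtain ⟨s, hs⟩ := hm.isTorsionElem_of_mem hc
  obtain ⟨u', p', hp', ⟨q'⟩⟩ := (hm.smul_path p q).recurrent.exists_path s
  refine (hm.isCotorsion_smul_path H h (p.comp p') (q'.comp q)).mono ?_
  rw [Submodule.span_singleton_le_iff_mem]
  have h0 := hs p'.length hp'.ge _ (ofPath_mem k p')
  rw [smul_smul_op, sub_mul, smul_mul_assoc, ofPath_mul_ofPath, MulOpposite.op_sub, sub_smul,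
    smul_base, sub_eq_zero] at h0
  have hmem : c • op (ofPath k (p.comp p')) • m ∈ N := by
    rw [← h0, ← smul_smul_op]
    exact N.smul_mem _ hbN
  have := N.smul_mem (op (c⁻¹ • (1 : PathAlgebra k V))) hmem
  rwa [← smul_base_eq, smul_smul, inv_mul_cancel₀ hc0, one_smul] at this

end IsCyclicGenerator

/-- Modules with cyclic generators of the same degree at the same vertex are isomorphic in the
quotient category. -/
theorem IsCyclicGenerator.nonempty_iso (H : UniqueSimpleCycles V) {x : M} {y : N}
    (hx : IsCyclicGenerator M v d x) (hy : IsCyclicGenerator N v d y)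
    (hxM : IsCotorsion M (Submodule.span _ {x})) (hyN : IsCotorsion N (Submodule.span _ {y})) :
    Nonempty ((QGr.proj k V).obj M ≅ (QGr.proj k V).obj N) :=
  nonempty_iso_of_generators hx.mem_deg hy.mem_deg
    (fun _ => by rw [hx.isTorsionElem_iff H, hy.isTorsionElem_iff H]) hxM hyN

/-- A module that is not torsion contains a cyclic generator. -/
theorem exists_isCyclicGenerator (H : UniqueSimpleCycles V) (hM : ¬ Tors k V M) :
    ∃ (v : V) (d : ℤ) (m : M), IsCyclicGenerator M v d m := by
  obtain ⟨x, hx⟩ := not_forall.1 hM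
  let P : V → Prop := fun v => ∃ (i : ℤ) (m : M), m ∈ M.deg i ∧
      op (ofPath k (Path.nil : Path v v)) • m = m ∧ ¬ M.IsTorsionElem m
  have hP : ∃ v, P v := by
    obtain ⟨i, v, m, -, h⟩ := exists_not_isTorsionElem (⊤ : Submodule (PathAlgebra k V)ᵐᵒᵖ M)
      (fun _ _ _ => trivial) (x := x) trivial hx
    exact ⟨v, i, m, h⟩
  let R : V → Set V := fun v => {u | Nonempty (Path v u)}
  -- Minimality makes non-torsion multiples return: if `m p` is not torsion, its end vertex reaches
  -- no fewer vertices than `v`, hence exactly the same ones, and `v` is among them.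
  obtain ⟨v, hv⟩ := exists_minimalFor_of_wellFoundedLT P (fun v => (R v).ncard) hP
  obtain ⟨d, m, hmd, hmv, hmt⟩ := hv.1
  have hret : ∀ {u : V} (p : Path v u), ¬ M.IsTorsionElem (op (ofPath k p) • m) →
      Nonempty (Path u v) := by
    intro u p hp
    have hu : P u := ⟨_, _, M.smul_mem_deg hmd (ofPath_mem k p), by
      rw [smul_smul_op, ofPath_mul_ofPath, Path.comp_nil], hp⟩
    have hsub : R u ⊆ R v := fun z hz => Nonempty.map p.comp hz
    have hle : (R v).ncard ≤ (R u).ncard := by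
      rcases le_total (R v).ncard (R u).ncard with h | h
      · exact h
      · exact hv.2 hu h
    have heq := Set.eq_of_subset_of_ncard_le hsub hle (Set.toFinite _)
    have : v ∈ R u := heq ▸ ⟨Path.nil⟩
    exact this
  have hlong : ∀ n : ℕ, ∃ (u : V) (p : Path v u), p.length = n ∧
      ¬ M.IsTorsionElem (op (ofPath k p) • m) := by
    intro n
    by_contra! hcon
    refine hmt (isTorsionElem_of_paths n m fun a b p hp => ?_)
    by_cases ha : a = v
    · subst ha
      exact hcon b p hp
    · rw [path_smul_eq_zero hmv p ha]
      exact isTorsionElem_zero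
  refine ⟨v, d, m, ?_, hmd, hmv, fun {u} p => ?_⟩
  · obtain ⟨u, p, hp, hpt⟩ := hlong 1
    obtain ⟨q⟩ := hret p hpt
    exact ⟨p.comp q, by simp [hp]⟩
  · rw [← not_nonempty_iff, ← not_iff_not, not_not]
    refine ⟨hret p, ?_⟩
    rintro ⟨q⟩
    -- Some path of this length gives a non-torsion multiple; it returns, so by uniqueness it is
    -- `p`.
    obtain ⟨u', p', hp', hpt⟩ := hlong p.length
    obtain ⟨q'⟩ := hret p' hpt
    obtain ⟨⟩ := H.path_unique _ p' p q' q hp' rfl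
    exact hpt

/-- A module that is not torsion contains a cyclic generator of non-negative degree. -/
theorem exists_isCyclicGenerator_nat (H : UniqueSimpleCycles V) (hM : ¬ Tors k V M) :
    ∃ (v : V) (n : ℕ) (m : M), IsCyclicGenerator M v n m := by
  obtain ⟨v, d, m, hm⟩ := exists_isCyclicGenerator H hM
  -- Going `|d|` steps along the cycle raises the degree to `d + |d| ≥ 0`, within the range of
  -- degrees of the modules `𝒪_w`.
  obtain ⟨u, p, hp, ⟨q⟩⟩ := hm.recurrent.exists_path d.natAbs
  have h := hm.smul_path p q
  refine ⟨u, (d + p.length).toNat, op (ofPath k p) • m, ?_⟩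
  rwa [Int.toNat_of_nonneg (by omega)]

end Quotient

end

end Gr

/-! ### Cyclic point modules in the quotient category -/

namespace Gr

noncomputable section

variable {k : Type u} [Field k] {V : Type v} [Quiver.{w} V] [Fintype V]

open MulOpposite PathAlgebra Quiver

variable (k) in
/-- The trivial path at `v`, as an element of `e_v kQ`. -/
def vertexGenerator (v : V) : vertexModule.{u, v, w} k v :=
  ⟨path k (Path.nil : Path v v), Submodule.mem_span_singleton_self _⟩

variable (k) in
/-- The projection of `e_v kQ` onto `𝒪_v`. -/
def pointProj (v : V) : vertexModule.{u, v, w} k v ⟶ cyclicPointModule k v :=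
  GrMod.quotπ (offCycle k v) (isHomogeneous_offCycle k v)

theorem pointProj_eq_zero_iff {v : V} (x : vertexModule.{u, v, w} k v) :
    (pointProj k v).lin x = 0 ↔ x ∈ offCycle k v :=
  Submodule.Quotient.mk_eq_zero _

variable (k) in
/-- The class of the trivial path at `v` in `𝒪_v`. -/
def pointGenerator (v : V) : cyclicPointModule.{u, v, w} k v :=
  (pointProj k v).lin (vertexGenerator k v)

theorem pointGenerator_mem_deg (v : V) :
    pointGenerator k v ∈ (cyclicPointModule.{u, v, w} k v).deg 0 :=
  (pointProj k v).map_deg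
    (show vertexGenerator k v ∈ (vertexModule k v).deg 0 from
      path_mem_deg k (Path.nil : Path v v))

theorem span_pointGenerator (v : V) :
    Submodule.span (PathAlgebra k V)ᵐᵒᵖ {pointGenerator.{u, v, w} k v} = ⊤ := by
  rw [eq_top_iff]
  rintro y -
  obtain ⟨⟨z, hz⟩, rfl⟩ := Submodule.mkQ_surjective _ y
  obtain ⟨a, rfl⟩ := Submodule.mem_span_singleton.1 hz
  exact Submodule.mem_span_singleton.2 ⟨a, rfl⟩

theorem vertexModuleInclusion_path_smul {v u : V} (p : Path v u) :
    (vertexModuleInclusion k v).lin (op (ofPath k p) • vertexGenerator k v) = path k p := by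
  change ofPath k (Path.nil : Path v v) * ofPath k p = ofPath k p
  rw [ofPath_mul_ofPath, Path.nil_comp]

/-- Allows non-vanishing in the quotient `𝒪_v` to be tested inside `kQ`. -/
theorem nonReturning_of_mem_offCycle (H : UniqueSimpleCycles V) {v : V} (hv : IsRecurrent v)
    {x : vertexModule.{u, v, w} k v} (hx : x ∈ offCycle k v) :
    ((vertexModuleInclusion k v).lin x : PathAlgebra k V) ∈ nonReturning k v := by
  induction hx using Submodule.span_induction with
  | mem x h =>
    obtain ⟨z, q, hz, hx⟩ := h
    rw [hx]
    refine Submodule.subset_span ⟨v, z, q, rfl, fun h => hz ?_⟩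
    exact (H.onSimpleCycleAt_iff hv q).2 h.2
  | zero => rw [map_zero]; exact Submodule.zero_mem _
  | add x y _ _ hx hy => rw [map_add]; exact Submodule.add_mem _ hx hy
  | smul a x _ hx => rw [map_smul]; exact mul_mem_nonReturning hx a.unop

theorem path_smul_pointGenerator_eq_zero (H : UniqueSimpleCycles V) {v u : V}
    (hv : IsRecurrent v) (p : Path v u) (hu : IsEmpty (Path u v)) :
    op (ofPath k p) • pointGenerator k v = 0 := by
  rw [pointGenerator, ← map_smul, pointProj_eq_zero_iff]
  refine Submodule.subset_span ⟨u, p, ?_, ?_⟩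
  · rw [H.onSimpleCycleAt_iff hv p, not_nonempty_iff]
    exact hu
  · exact vertexModuleInclusion_path_smul p

theorem path_smul_pointGenerator_ne_zero (H : UniqueSimpleCycles V) {v u : V}
    (hv : IsRecurrent v) (p : Path v u) (q : Path u v) :
    op (ofPath k p) • pointGenerator k v ≠ 0 := by
  intro h0
  rw [pointGenerator, ← map_smul, pointProj_eq_zero_iff] at h0
  have h := nonReturning_of_mem_offCycle H hv h0
  rw [vertexModuleInclusion_path_smul] at h
  exact ofPath_notMem_nonReturning p q h

theorem vertex_smul_pointGenerator (v : V) :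
    op (ofPath k (Path.nil : Path v v)) • pointGenerator.{u, v, w} k v = pointGenerator k v := by
  rw [pointGenerator, ← map_smul]
  refine congrArg _ (Subtype.ext ?_)
  exact vertexModuleInclusion_path_smul (Path.nil : Path v v)

/-- A returning path can be prolonged to returning paths of every length, none of which vanishes in
`𝒪_v`; a path without a way back is already zero there. -/
theorem isCyclicGenerator_pointGenerator (H : UniqueSimpleCycles V) {v : V}
    (hv : IsRecurrent v) :
    IsCyclicGenerator (cyclicPointModule.{u, v, w} k v) v 0 (pointGenerator k v) where
  recurrent := hv
  mem_deg := pointGenerator_mem_deg v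
  vertex_smul := vertex_smul_pointGenerator v
  torsion_iff {u} p := by
    constructor
    · rintro ⟨n, hn⟩
      refine ⟨fun q => ?_⟩
      obtain ⟨x, r, hr, ⟨s⟩⟩ := (isRecurrent_of_path hv p q).exists_path n
      have h := hn r.length hr.ge _ (ofPath_mem k r)
      rw [smul_smul_op, ofPath_mul_ofPath] at h
      exact path_smul_pointGenerator_ne_zero H hv (p.comp r) (s.comp q) h
    · intro hu
      rw [path_smul_pointGenerator_eq_zero H hv p hu]
      exact isTorsionElem_zero

theorem isCotorsion_span_pointGenerator (v : V) : IsCotorsion (cyclicPointModule.{u, v, w} k v)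
    (Submodule.span _ {pointGenerator k v}) := by
  rw [span_pointGenerator]
  exact fun _ => ⟨0, fun _ _ _ _ => trivial⟩

theorem smul_pointGenerator_eq_zero (H : UniqueSimpleCycles V) {v : V} (hv : IsRecurrent v)
    {a : PathAlgebra k V} (ha : a ∈ nonReturning k v) : op a • pointGenerator k v = 0 := by
  induction ha using Submodule.span_induction with
  | mem x h =>
    obtain ⟨a, b, p, rfl, h⟩ := h
    by_cases hav : a = v
    · subst hav
      exact path_smul_pointGenerator_eq_zero H hv p (not_nonempty_iff.1 fun h' => h ⟨rfl, h'⟩)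
    · exact path_smul_eq_zero (vertex_smul_pointGenerator v) p hav
  | zero => simp
  | add x y _ _ hx hy => rw [MulOpposite.op_add, add_smul, hx, hy, add_zero]
  | smul c x _ hx => rw [smul_base, hx, smul_zero]

/-- `𝒪_v` is a point module. -/
theorem isPointModule_cyclicPointModule (H : UniqueSimpleCycles V) {v : V}
    (hv : IsRecurrent v) : (cyclicPointModule.{u, v, w} k v).IsPointModule := by
  constructor
  · rw [eq_top_iff, ← span_pointGenerator]
    exact Submodule.span_mono (Set.singleton_subset_iff.2 (pointGenerator_mem_deg v))
  · intro i
    obtain ⟨u, p, rfl, ⟨q⟩⟩ := hv.exists_path i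
    have hdeg : op (ofPath k p) • pointGenerator k v ∈
        (cyclicPointModule k v).deg (p.length : ℤ) := by
      have := (cyclicPointModule k v).smul_mem_deg (pointGenerator_mem_deg v) (ofPath_mem k p)
      rwa [zero_add] at this
    -- The class of the only returning path of this length spans the component.
    refine (finrank_eq_one_iff_of_nonzero' (⟨_, hdeg⟩ : (cyclicPointModule k v).deg p.length)
      (fun h => path_smul_pointGenerator_ne_zero (k := k) H hv p q
        (congrArg Subtype.val h))).2 ?_
    rintro ⟨z, hz⟩
    have hzs : z ∈ Submodule.span (PathAlgebra k V)ᵐᵒᵖ {pointGenerator k v} := by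
      rw [span_pointGenerator]; trivial
    obtain ⟨a, rfl⟩ := Submodule.mem_span_singleton.1 hzs
    have hcomp := component_op_smul (pointGenerator_mem_deg (k := k) v) a.unop p.length
    rw [op_unop, zero_add, GrMod.component_of_mem _ hz] at hcomp
    obtain ⟨c, hc⟩ := exists_sub_mem_nonReturning H p q (Subtype.coe_prop
      (DirectSum.decompose (grading k (V := V)) a.unop p.length))
    have h0 := smul_pointGenerator_eq_zero H hv hc
    rw [MulOpposite.op_sub, sub_smul, smul_base, sub_eq_zero] at h0
    exact ⟨c, Subtype.ext (h0.symm.trans hcomp.symm)⟩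

variable {M : Gr.{u, v, w} k V}

/-- Since `M₀` is a line, one element `g` of it generates `M`; were `g` torsion, `M` would vanish in
large degrees. -/
theorem not_tors_of_isPointModule (hM : M.IsPointModule) : ¬ Tors k V M := by
  intro ht
  obtain ⟨⟨g, hg⟩, -, hg'⟩ := finrank_eq_one_iff'.1 (hM.2 0)
  have hspan : Submodule.span (PathAlgebra k V)ᵐᵒᵖ {g} = ⊤ := by
    rw [eq_top_iff, ← hM.1, Submodule.span_le]
    intro y hy
    obtain ⟨c, hc⟩ := hg' ⟨y, hy⟩
    rw [← show c • g = y from congrArg Subtype.val hc, smul_base_eq]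
    exact Submodule.smul_mem _ _ (Submodule.mem_span_singleton_self g)
  obtain ⟨n, hn⟩ := ht g
  obtain ⟨⟨z, hz⟩, hz0, -⟩ := finrank_eq_one_iff'.1 (hM.2 n)
  obtain ⟨a, ha⟩ := Submodule.mem_span_singleton.1 (hspan ▸ Submodule.mem_top : z ∈ _)
  have hcomp := component_op_smul hg a.unop n
  rw [op_unop, ha, Nat.cast_zero, zero_add, GrMod.component_of_mem _ hz,
    hn n le_rfl _ (Subtype.coe_prop _)] at hcomp
  exact hz0 (Subtype.ext hcomp)

/-- In a point module, a cyclic generator generates a submodule with torsion quotient. -/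
theorem IsCyclicGenerator.isCotorsion_of_isPointModule (hM : M.IsPointModule) {v : V} {n : ℕ}
    {m : M} (hm : IsCyclicGenerator M v n m) : IsCotorsion M (Submodule.span _ {m}) := by
  intro y
  induction y using GrMod.deg_induction with
  | hom j y hy =>
    -- From this bound on, `j + i ≥ n`, so some returning `p` puts `m p ≠ 0` in the one-dimensional
    -- component of degree `j + i`, which it spans.
    refine ⟨(n - j).toNat, fun i hi a ha => ?_⟩
    obtain ⟨u, p, hp, ⟨q⟩⟩ := hm.recurrent.exists_path (j + i - n).toNat
    have hya := M.smul_mem_deg hy ha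
    have hmp := (hm.smul_path p q).mem_deg
    have hdeg : (n : ℤ) + p.length = ((j + i).toNat : ℕ) := by omega
    have hdeg' : j + (i : ℤ) = ((j + i).toNat : ℕ) := by omega
    rw [hdeg] at hmp
    rw [hdeg'] at hya
    have hne : (⟨_, hmp⟩ : M.deg ((j + i).toNat : ℕ)) ≠ 0 := by
      intro h0
      refine hm.not_isTorsionElem_path p q ?_
      rw [show op (ofPath k p) • m = 0 from congrArg Subtype.val h0]
      exact isTorsionElem_zero
    obtain ⟨c, hc⟩ := (finrank_eq_one_iff_of_nonzero' _ hne).1 (hM.2 _) ⟨_, hya⟩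
    rw [← show c • op (ofPath k p) • m = op a • y from congrArg Subtype.val hc, smul_base_eq]
    exact Submodule.smul_mem _ _
      (Submodule.smul_mem _ _ (Submodule.mem_span_singleton_self m))
  | zero => exact ⟨0, fun _ _ _ _ => by rw [smul_zero]; exact Submodule.zero_mem _⟩
  | add x y hx hy =>
    obtain ⟨n₁, h₁⟩ := hx
    obtain ⟨n₂, h₂⟩ := hy
    refine ⟨n₁ + n₂, fun i hi a ha => ?_⟩
    rw [smul_add]
    exact Submodule.add_mem _ (h₁ i (by omega) a ha) (h₂ i (by omega) a ha)

/-! ### Classification of simple objects and point modules -/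

section Quotient

variable [∀ a b : V, Finite (a ⟶ b)]

/-- A module with a cyclic generator of non-negative degree is isomorphic in the quotient category
to a cyclic point module. -/
theorem IsCyclicGenerator.nonempty_iso_cyclicPointModule (H : UniqueSimpleCycles V) {v : V}
    {n : ℕ} {m : M} (hm : IsCyclicGenerator M v n m)
    (h : IsCotorsion M (Submodule.span _ {m})) : ∃ w : V, IsCyclicVertex w ∧
      Nonempty ((QGr.proj k V).obj M ≅ (QGr.proj k V).obj (cyclicPointModule k w)) := by
  obtain ⟨c, hc⟩ := hm.recurrent
  have hle : n ≤ (c.iter n).length := by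
    rw [Path.length_iter]; exact Nat.le_mul_of_pos_right n hc
  -- The last `n` arrows of the iterate form a path `p` from `w` to `v`, and the rest `q` leads
  -- back. So in `𝒪_w` the class of `p` is a cyclic generator at `v` of degree `n`, like `m`.
  obtain ⟨w, q, p, hqp, hq⟩ := (c.iter n).exists_eq_comp_of_le_length
    (Nat.sub_le (c.iter n).length n)
  have hp : p.length = n := by
    have := congrArg Path.length hqp
    rw [Path.length_comp] at this
    omega
  have hw : IsRecurrent w := isRecurrent_of_path hm.recurrent q p
  have hx := isCyclicGenerator_pointGenerator (k := k) H hw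
  have hxp := hx.smul_path p q
  rw [zero_add, hp] at hxp
  exact ⟨w, hw.isCyclicVertex, hm.nonempty_iso H hxp h
    (hx.isCotorsion_smul_path H (isCotorsion_span_pointGenerator w) p q)⟩

/-- Isomorphic cyclic point modules in the quotient category belong to the same vertex. -/
theorem eq_of_cyclicPointModule_iso (H : UniqueSimpleCycles V) {v w : V} (hv : IsRecurrent v)
    (hw : IsRecurrent w) (e : (QGr.proj k V).obj (cyclicPointModule k v) ≅
      (QGr.proj k V).obj (cyclicPointModule k w)) : v = w := by
  by_contra hvw
  have hx := isCyclicGenerator_pointGenerator (k := k) H hv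
  have hy := isCyclicGenerator_pointGenerator (k := k) H hw
  obtain ⟨X, s, f, hs, hf⟩ := exists_roof_of_iso e
  obtain ⟨n₀, hn₀⟩ := hs (pointGenerator k v)
  obtain ⟨c, hc⟩ := hv
  obtain ⟨c', hc'⟩ := hw
  -- The exponents give closed paths at `v` and at `w` of the common length `n₀ * |c| * |c'|`, which
  -- is at least `n₀`.
  have hlen : (c.iter (n₀ * c'.length)).length = (c'.iter (n₀ * c.length)).length := by
    rw [Path.length_iter, Path.length_iter]; ring
  have hle : n₀ ≤ (c'.iter (n₀ * c.length)).length := by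
    rw [Path.length_iter, mul_assoc]
    exact Nat.le_mul_of_pos_right n₀ (Nat.mul_pos hc hc')
  set p := c.iter (n₀ * c'.length)
  set p' := c'.iter (n₀ * c.length)
  obtain ⟨z, hz⟩ := hn₀ p.length (by rwa [hlen]) _ (ofPath_mem k p)
  let ev : PathAlgebra k V := ofPath k (Path.nil : Path v v)
  -- Passing to one degree and multiplying by `e_v` makes the preimage homogeneous and supported at
  -- `v`; its image is unchanged because `p` ends at `v`.
  let z' : X := op ev • X.component p.length z
  have hz'_deg : z' ∈ X.deg p.length := by
    have := X.smul_mem_deg (X.component_mem p.length z)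
      (ofPath_mem k (Path.nil : Path v v))
    simpa using this
  have hsz' : s.lin z' = op (ofPath k p) • pointGenerator k v := by
    have hdeg := (hx.smul_path p Path.nil).mem_deg
    rw [zero_add] at hdeg
    rw [map_smul, GrMod.Hom.lin_component, hz, GrMod.component_of_mem _ hdeg, smul_smul_op,
      ofPath_mul_ofPath, Path.comp_nil]
  have hz't : ¬ X.IsTorsionElem z' := fun ht =>
    hx.not_isTorsionElem_path p .nil (hsz' ▸ isTorsionElem_map ht s)
  have hft : ¬ (cyclicPointModule k w).IsTorsionElem (f.lin z') := by
    rintro ⟨n, hn⟩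
    refine hz't (isTorsionElem_of_tail X n z' fun i hi a ha => hf _ ?_)
    rw [map_smul, hn i hi a ha]
  have hspan : f.lin z' ∈ Submodule.span (PathAlgebra k V)ᵐᵒᵖ {pointGenerator k w} := by
    rw [span_pointGenerator]; trivial
  obtain ⟨a, ha⟩ := Submodule.mem_span_singleton.1 hspan
  have hcomp := component_op_smul (pointGenerator_mem_deg (k := k) w) a.unop p'.length
  rw [op_unop, zero_add, ha, ← hlen, GrMod.component_of_mem _ (f.map_deg hz'_deg), hlen] at hcomp
  have hev : op ev • f.lin z' = f.lin z' := by
    rw [← map_smul, smul_smul_op, ofPath_mul_ofPath, Path.comp_nil]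
  obtain ⟨b, hb⟩ := exists_sub_mem_nonReturning H p' .nil (Subtype.coe_prop
    (DirectSum.decompose (grading k (V := V)) a.unop p'.length))
  refine hft ?_
  -- In this degree the coefficient is a multiple of `p'` modulo `nonReturning k w`. As `p'` ends at
  -- `w ≠ v`, multiplication by `e_v` kills it, so `f.lin z'` would be torsion.
  rw [← hev, hcomp, smul_smul_op]
  refine hy.isTorsionElem_of_mem ?_
  have := mul_mem_nonReturning hb ev
  rwa [sub_mul, smul_mul_assoc, ofPath_mul_ofPath_of_ne k p' _ hvw, smul_zero, sub_zero] at this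

/-- A point module is isomorphic in the quotient category to a cyclic point module. -/
theorem exists_iso_of_isPointModule (H : UniqueSimpleCycles V) (hM : M.IsPointModule) :
    ∃ v : V, IsCyclicVertex v ∧
      Nonempty ((QGr.proj k V).obj M ≅ (QGr.proj k V).obj (cyclicPointModule k v)) := by
  obtain ⟨v, n, m, hm⟩ := exists_isCyclicGenerator_nat H (not_tors_of_isPointModule hM)
  exact hm.nonempty_iso_cyclicPointModule H (hm.isCotorsion_of_isPointModule hM)

/-- A simple object of the quotient category is isomorphic to a cyclic point module. -/
theorem exists_iso_of_simple (H : UniqueSimpleCycles V) (S : QGr.{u, v, w} k V) [Simple S] :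
    ∃ v : V, IsCyclicVertex v ∧
      Nonempty (S ≅ (QGr.proj k V).obj (cyclicPointModule k v)) := by
  have := Localization.essSurj (QGr.proj.{u, v, w} k V) (Tors k V).isoModSerre
  let e := (QGr.proj.{u, v, w} k V).objObjPreimageIso S
  have hS : Simple ((QGr.proj.{u, v, w} k V).obj ((QGr.proj.{u, v, w} k V).objPreimage S)) :=
    Simple.of_iso e
  obtain ⟨v, n, m, hm⟩ := exists_isCyclicGenerator_nat (k := k)
    (M := (QGr.proj.{u, v, w} k V).objPreimage S) H fun ht =>
    Simple.not_isZero _ (isZero_proj_obj_iff.2 ht)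
  obtain ⟨w, hw, ⟨e'⟩⟩ := hm.nonempty_iso_cyclicPointModule H
    (isCotorsion_of_simple _ hm.isHomogeneous_span (Submodule.mem_span_singleton_self m)
      hm.not_isTorsionElem)
  exact ⟨w, hw, ⟨e.symm ≪≫ e'⟩⟩

end Quotient

end

end Gr

theorem theorem5p7 {k : Type u} [Field k] {V : Type v} [Quiver.{w} V] [Fintype V]
    [∀ a b : V, Finite (a ⟶ b)] (hGK : gkDim k (PathAlgebra k V) < ⊤) :
    -- each `𝒪_v` is a point module, and is a simple object of `QGr kQ`
    (∀ v : V, Quiver.IsCyclicVertex v → (Gr.cyclicPointModule k v).IsPointModule) ∧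
    (∀ v : V, Quiver.IsCyclicVertex v →
      Simple ((QGr.proj k V).obj (Gr.cyclicPointModule k v))) ∧
    -- completeness
    (∀ S : QGr k V, Simple S → ∃ v : V, Quiver.IsCyclicVertex v ∧
      Nonempty (S ≅ (QGr.proj k V).obj (Gr.cyclicPointModule k v))) ∧
    -- irredundancy
    (∀ v w : V, Quiver.IsCyclicVertex v → Quiver.IsCyclicVertex w →
      Nonempty ((QGr.proj k V).obj (Gr.cyclicPointModule k v) ≅
        (QGr.proj k V).obj (Gr.cyclicPointModule k w)) → v = w) ∧
    -- every point module is isomorphic in `QGr kQ` to some `𝒪_v`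
    (∀ P : Gr k V, P.IsPointModule → ∃ v : V, Quiver.IsCyclicVertex v ∧
      Nonempty ((QGr.proj k V).obj P ≅ (QGr.proj k V).obj (Gr.cyclicPointModule k v))) ∧
    -- there are finitely many point modules up to isomorphism in `QGr kQ`
    {c : Quotient (isIsomorphicSetoid (QGr k V)) | ∃ P : Gr k V, P.IsPointModule ∧
      c = Quotient.mk _ ((QGr.proj k V).obj P)}.Finite := by
  have H := PathAlgebra.uniqueSimpleCycles_of_gkDim_lt_top hGK
  refine ⟨fun v hv => Gr.isPointModule_cyclicPointModule H hv.isRecurrent, fun v hv => ?_,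
    fun S _ => Gr.exists_iso_of_simple H S, ?_, fun P hP => Gr.exists_iso_of_isPointModule H hP, ?_⟩
  · exact (Gr.isCyclicGenerator_pointGenerator H hv.isRecurrent).simple H
      (Gr.isCotorsion_span_pointGenerator v)
  · rintro v w hv hw ⟨e⟩
    exact Gr.eq_of_cyclicPointModule_iso H hv.isRecurrent hw.isRecurrent e
  -- There are only finitely many vertices, so the larger set of classes for all `v`, cyclic or not,
  -- is already finite.
  · refine (Set.finite_range fun v : V => (Quotient.mk (isIsomorphicSetoid (QGr k V))
      ((QGr.proj k V).obj (Gr.cyclicPointModule k v)))).subset ?_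
    rintro _ ⟨P, hP, rfl⟩
    obtain ⟨v, -, e⟩ := Gr.exists_iso_of_isPointModule H hP
    exact ⟨v, (Quotient.sound e).symm⟩
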